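/- **Setting.** Let $a,b$ be relatively prime positive integers, let $m,k\ge 0$, and let $q$ be an indeterminate. Paths are lattice paths from $(0,0)$ to $(k,m)$, i.e. words with $m$ letters $N$ (north step) and $k$ letters $E$ (east step). The Young diagram of a path $\lambda$ is the set of unit boxes of $[0,k]\times[0,m]$ above it. Write $\lambda\le\mu$ ($\mu$ is above $\lambda$) if the Young diagram of $\mu$ is contained in that of $\lambda$; the region $\lambda/\mu$ above $\lambda$ and below $\mu$ is then the difference of the two diagrams. An *$(a,b)$-enlarged Dyck path of size $n$* is a word $p^{(a,b)}$ obtained from a Dyck word $p$ with $n$ letters $N$ and $n$ letters $E$ ($n\ge0$) by replacing each $N$ by $N^a$ and each $E$ by $E^b$. Let $\mathcal S$ be either the set of all $(a,b)$-enlarged Dyck paths, or the set of those that are not a concatenation of two nonempty $(a,b)$-enlarged Dyck paths. **The matrices.** For a path $\pi=\pi_1\cdots\pi_r$, $r=m+k$, a pair $(i,j)$ with $i<j$, $\pi_i=N$, $\pi_j=E$ is *admissible* if $\pi_{i+1}\cdots\pi_{j-1}\in\mathcal S$. The $NE$-flip by $(i,j)$ exchanges $\pi_i$ and $\pi_j$;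 its weight of type I is $-q$, and its weight of type II is $-q^{n_E+1}$, where $n_E$ is the number of $E$'s in $\pi_{i+1}\cdots\pi_{j-1}$. No two admissible pairs of $\pi$ share a position, so all pairs in a set $F$ of admissible pairs of $\pi$ can be flipped, in any order, and a path $\pi'$ is obtained from $\pi$ in this way for at most one $F$. Let $M_{\pi',\pi}$ (resp. $N_{\pi',\pi}$) be the product of the type I (resp. type II) weights of the flips in $F$ if $\pi'$ is obtained from $\pi$ by flipping the pairs in $F$, and $0$ if there is no such $F$. **Tilings.** A *tile of size $n$* is a set of boxes whose centers are the successive lattice points of a translate of a path of size $n$ in $\mathcal S$ (a single box if $n=0$). An *$(a,b)$-Dyck tiling* of $\lambda/\mu$, where $\lambda\le\mu$, is a partition of $\lambda/\mu$ into tiles. It is *cover-inclusive* if each tile, moved by $(1,-1)$, either is contained in another tile or lies entirely below $\lambda$. For a tile $d$ of size $n$ put $\mathrm{tiles}(d)=1$, $\mathrm{area}(d)=an+bn+1$ and $\mathrm{art}(d)=(a\,\mathrm{tiles}(d)+b\,\mathrm{area}(d))/(a+b)=bn+1$. **Theorem.** For either choice of $\mathcal S$, the matrices $M$ and $N$ are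 invertible over $\mathbb Z[q]$, and for all paths $\pi',\pi$ from $(0,0)$ to $(k,m)$ $$M^{-1}_{\pi',\pi}=\sum_{\mathcal D}\prod_{d\in\mathcal D}q^{\mathrm{tiles}(d)},\qquad N^{-1}_{\pi',\pi}=\sum_{\mathcal D}\prod_{d\in\mathcal D}q^{\mathrm{art}(d)},$$ where $\mathcal D$ runs over the cover-inclusive $(a,b)$-Dyck tilings of the region above $\pi'$ and below $\pi$ (there are none unless $\pi'\le\pi$). -/

import Mathlib

/-! ### Words and lattice paths

North steps `N` are written `DyckStep.U`, east steps `E` are written `DyckStep.D`. -/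

instance DyckStep.instFintypeStep : Fintype DyckStep :=
  ⟨{DyckStep.U, DyckStep.D}, by intro x; cases x <;> simp⟩

/-- Lattice paths from `(0,0)` to `(k,m)`: words with `m` north steps and `k` east steps. -/
abbrev LatticePath (m k : ℕ) : Type :=
  {π : Fin (m + k) → DyckStep // (Finset.univ.filter fun i => π i = DyckStep.U).card = m}

/-- The word `p^{(a,b)}`: every `N` becomes `N^a` and every `E` becomes `E^b`. -/
def enlarge (a b : ℕ) (p : List DyckStep) : List DyckStep :=
  p.flatMap fun s => match s with
    | DyckStep.U => List.replicate a DyckStep.U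
    | DyckStep.D => List.replicate b DyckStep.D

/-- The set of all `(a,b)`-enlarged Dyck paths `p^{(a,b)}`, with `p` a `(1,1)`-Dyck path
(possibly empty). -/
def enlargedPaths (a b : ℕ) : Set (List DyckStep) :=
  {w | ∃ p : DyckWord, w = enlarge a b p.toList}

/-- The `(a,b)`-enlarged Dyck paths that are not the concatenation of two nonempty
`(a,b)`-enlarged Dyck paths. The empty path is one of them. -/
def indecomposableEnlargedPaths (a b : ℕ) : Set (List DyckStep) :=
  {w | w ∈ enlargedPaths a b ∧
    ¬ ∃ u v : List DyckStep, u ∈ enlargedPaths a b ∧ v ∈ enlargedPaths a b ∧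
      u ≠ [] ∧ v ≠ [] ∧ w = u ++ v}

/-! ### `NE`-flips and the incidence matrices

The argument `S` is the set of words that may occur between the two letters of an
admissible pair. -/

/-- The partial word of `π` strictly between the positions `i` and `j`. -/
def between {m k : ℕ} (π : LatticePath m k) (i j : Fin (m + k)) : List DyckStep :=
  ((List.ofFn π.1).drop (i.1 + 1)).take (j.1 - (i.1 + 1))

/-- `(i,j)` is an admissible pair of `π`. -/
def IsAdmissible (S : Set (List DyckStep)) {m k : ℕ} (π : LatticePath m k)
    (f : Fin (m + k) × Fin (m + k)) : Prop :=
  f.1 < f.2 ∧ π.1 f.1 = DyckStep.U ∧ π.1 f.2 = DyckStep.D ∧ between π f.1 f.2 ∈ S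

open Classical in
/-- The set `F(π)` of admissible pairs of `π`. -/
noncomputable def admissiblePairs (S : Set (List DyckStep)) {m k : ℕ} (π : LatticePath m k) :
    Finset (Fin (m + k) × Fin (m + k)) :=
  Finset.univ.filter (IsAdmissible S π)

open Classical in
/-- The word obtained from `π` by exchanging the letters `N` and `E` of every pair `(i,j)` in
`F`. No two admissible pairs of a path share a position, so for `F ⊆ F(π)` this is the end of
the chain of the single flips by the members of `F`, in whatever order they are made. -/
noncomputable def flipPairs {m k : ℕ} (π : LatticePath m k)
    (F : Finset (Fin (m + k) × Fin (m + k))) : Fin (m + k) → DyckStep := fun x =>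
  if ∃ f ∈ F, f.1 = x then DyckStep.D
  else if ∃ f ∈ F, f.2 = x then DyckStep.U
  else π.1 x

open Classical in
/-- The sets `F` of admissible pairs of `π` whose flips turn `π` into `π'`. There is at most one
such set, since the first entries of its members are the positions at which `π` has an `N` and
`π'` has an `E`. -/
noncomputable def flipSets (S : Set (List DyckStep)) {m k : ℕ} (π' π : LatticePath m k) :
    Finset (Finset (Fin (m + k) × Fin (m + k))) :=
  (admissiblePairs S π).powerset.filter fun F => flipPairs π F = π'.1

/-- The weight of type I of the flip by one pair: `-q`. -/
noncomputable def flipWeightI {m k : ℕ} (_π : LatticePath m k)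
    (_f : Fin (m + k) × Fin (m + k)) : Polynomial ℤ :=
  -Polynomial.X

/-- The weight of type II of the flip by one pair: `-q^(n_E + 1)`, with `n_E` the number of `E`s
strictly between the two positions. -/
noncomputable def flipWeightII {m k : ℕ} (π : LatticePath m k)
    (f : Fin (m + k) × Fin (m + k)) : Polynomial ℤ :=
  -Polynomial.X ^ ((between π f.1 f.2).count DyckStep.D + 1)

/-- The matrix `M`: the entry at `(π', π)` is the product of the type I weights of the flips that
lead from `π` to `π'`, and `0` if there are no such flips. -/
noncomputable def matM (S : Set (List DyckStep)) (m k : ℕ) :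
    Matrix (LatticePath m k) (LatticePath m k) (Polynomial ℤ) :=
  Matrix.of fun π' π => ∑ F ∈ flipSets S π' π, ∏ f ∈ F, flipWeightI π f

/-- The matrix `N`: the same with the weights of type II. -/
noncomputable def matN (S : Set (List DyckStep)) (m k : ℕ) :
    Matrix (LatticePath m k) (LatticePath m k) (Polynomial ℤ) :=
  Matrix.of fun π' π => ∑ F ∈ flipSets S π' π, ∏ f ∈ F, flipWeightII π f

/-! ### Dyck tilings

A box is given by its lower left corner. -/

/-- The number of letters `s` of `π` before position `i`. -/
def countBefore {m k : ℕ} (π : LatticePath m k) (s : DyckStep) (i : Fin (m + k)) : ℕ :=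
  (Finset.univ.filter fun j => j < i ∧ π.1 j = s).card

open Classical in
/-- The Young diagram of `π`: the boxes of the rectangle `[0,k] × [0,m]` above `π`. The box with
lower left corner `(x,y)` is above `π` iff the east step of `π` in the column `[x,x+1]` has
height at most `y`. -/
noncomputable def young {m k : ℕ} (π : LatticePath m k) : Finset (ℤ × ℤ) :=
  (Finset.Ico (0 : ℤ) (k : ℤ) ×ˢ Finset.Ico (0 : ℤ) (m : ℤ)).filter fun c =>
    ∃ i : Fin (m + k), π.1 i = DyckStep.D ∧
      (countBefore π DyckStep.D i : ℤ) = c.1 ∧ (countBefore π DyckStep.U i : ℤ) ≤ c.2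

/-- The boxes visited by the word `w` (a path through centers of boxes) starting at the box `c`. -/
def pathBoxes : ℤ × ℤ → List DyckStep → Finset (ℤ × ℤ)
  | c, [] => {c}
  | c, DyckStep.U :: w => insert c (pathBoxes (c.1, c.2 + 1) w)
  | c, DyckStep.D :: w => insert c (pathBoxes (c.1 + 1, c.2) w)

/-- `d` is a tile: a ribbon whose centers form a path in `S`. -/
def IsDyckTile (S : Set (List DyckStep)) (d : Finset (ℤ × ℤ)) : Prop :=
  ∃ w ∈ S, ∃ c : ℤ × ℤ, d = pathBoxes c w

/-- `D` is a tiling, by tiles with paths in `S`, of the region `lam / mu` above `lam` and below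
`mu`; this includes that `mu` is above `lam`. -/
def IsDyckTiling (S : Set (List DyckStep)) {m k : ℕ} (lam mu : LatticePath m k)
    (D : Finset (Finset (ℤ × ℤ))) : Prop :=
  young mu ⊆ young lam ∧
  (∀ d ∈ D, IsDyckTile S d) ∧
  (∀ d₁ ∈ D, ∀ d₂ ∈ D, d₁ ≠ d₂ → Disjoint d₁ d₂) ∧
  D.biUnion id = young lam \ young mu

/-- The translate of `d` by `(1,-1)`. -/
def shiftSE (d : Finset (ℤ × ℤ)) : Finset (ℤ × ℤ) :=
  d.image fun c => (c.1 + 1, c.2 - 1)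

/-- Cover-inclusiveness of a tiling above `lam`: every tile moved by `(1,-1)` is contained in
another tile or is below `lam`. (A box that such a move takes out of the rectangle
`[0,k] × [0,m]` leaves it to the right or at the bottom, so it is below `lam` too.) -/
def IsCoverInclusive {m k : ℕ} (lam : LatticePath m k) (D : Finset (Finset (ℤ × ℤ))) : Prop :=
  ∀ d₁ ∈ D, (∃ d₂ ∈ D, d₂ ≠ d₁ ∧ shiftSE d₁ ⊆ d₂) ∨ (∀ c ∈ shiftSE d₁, c ∉ young lam)

open Classical in
/-- The cover-inclusive tilings, by tiles with paths in `S`, of the region above `lam` and below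
`mu`. -/
noncomputable def coverInclusiveTilings (S : Set (List DyckStep)) {m k : ℕ}
    (lam mu : LatticePath m k) : Finset (Finset (Finset (ℤ × ℤ))) :=
  (young lam \ young mu).powerset.powerset.filter fun D =>
    IsDyckTiling S lam mu D ∧ IsCoverInclusive lam D

/-- The statistic `tiles` of a tile. -/
def tilesStat (_d : Finset (ℤ × ℤ)) : ℕ := 1

/-- The statistic `area` of a tile: its number of boxes, `a n + b n + 1` for a tile of size `n`. -/
def areaStat (d : Finset (ℤ × ℤ)) : ℕ := d.card

/-- The statistic `art = (a tiles + b area) / (a + b)` of a tile. The division is exact: the value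
is `b n + 1` for a tile of size `n`. -/
def artStat (a b : ℕ) (d : Finset (ℤ × ℤ)) : ℕ := (a * tilesStat d + b * areaStat d) / (a + b)

/-!
Both inverses are left inverses given by the tilings: the sum over `ρ` of (tilings of `lam / ρ`)
times (flips from `π` to `ρ`) is a signed sum over triples of a path `ρ`, a set `F` of admissible
pairs of `π` whose flips lead to `ρ`, and a cover-inclusive tiling `D` of `lam / ρ`. A
sign-reversing involution cancels all triples except the one without flips and tiles, which occurs
only for `lam = π`.

A flip of the pair `(i, j)` sweeps out a tile whose weight is that of the flip up to the sign. The
involution moves one such tile: a flipped pair is given back to the tiling, or a tile that borders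
`ρ` along an admissible pair of `π` is removed from the tiling and the pair is flipped instead
(`IsTogglable`, `IsConfig.toggle`). Two pairs that can be moved are never nested
(`IsConfig.not_nested`), so that moving one of them does not change the set of pairs that can be
moved (`IsConfig.isTogglable_toggle`); any choice that depends on this set alone is an involution.

The point is that some pair can be moved (`IsConfig.exists_isTogglable`). Give north steps the
height `b` and east steps the height `-a`; the words of `S` return to their initial level and do not
go below it, and this is all that is needed of `S` (`IsBallot`). Without flips, a tile of `D` of
highest base level borders `ρ` along an admissible pair (`exists_flippable_tile`). Otherwise let `f`
be an innermost flipped pair. If some tile of `D` lies strictly within the range of `f`, such a tile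
of highest base level can be flipped. If there is none, then the boxes below the tile of `f` are
covered by a single tile, or are all below `lam` (`exists_tile_bordering`), and `f` can be given
back.

A box is addressed by the antidiagonal `i` through two of its corners and by its column `x`
(`boxAt`), a path by the number of its east steps before `i` (`eastCount`). Then the region
`lam / mu` is given by `eastCount mu i ≤ x < eastCount lam i`, and the move by `(1,-1)` is
`x ↦ x + 1`.
-/

open Finset

/-! ### Paths as counting functions -/

/-- The number of east steps among the letters of `π` before position `i`, for `i : ℤ`. It
determines the point of `π` on the antidiagonal `x + y = i`, and it is constant outside
`0 ≤ i ≤ m + k`. -/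
def eastCount {m k : ℕ} (π : LatticePath m k) (i : ℤ) : ℤ :=
  ((univ.filter fun j : Fin (m + k) => (j : ℤ) < i ∧ π.1 j = DyckStep.D).card : ℤ)

/-- The box whose north-west and south-east corners lie on the antidiagonal `x + y = i`, in the
column `[x, x + 1]`. In these coordinates the translation by `(1,-1)` is `x ↦ x + 1`. -/
def boxAt (i x : ℤ) : ℤ × ℤ := (x, i - 1 - x)

theorem eq_boxAt (c : ℤ × ℤ) : c = boxAt (c.1 + c.2 + 1) c.1 := by
  ext <;> simp [boxAt]

theorem exists_eq_boxAt (c : ℤ × ℤ) : ∃ i x, c = boxAt i x := ⟨_, _, eq_boxAt c⟩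

theorem boxAt_mem_shiftSE {d : Finset (ℤ × ℤ)} {i x : ℤ} :
    boxAt i x ∈ shiftSE d ↔ boxAt i (x - 1) ∈ d := by
  simp only [shiftSE, mem_image, boxAt, Prod.ext_iff]
  constructor
  · rintro ⟨⟨u, v⟩, h, h1, h2⟩
    simp only at h1 h2
    have h3 : u = x - 1 := by omega
    have h4 : v = i - 1 - (x - 1) := by omega
    rwa [← h3, ← h4] at *
  · intro h
    exact ⟨_, h, by simp, by simp only; omega⟩

section Counting

variable {m k : ℕ} (π : LatticePath m k)

theorem DyckStep.eq_U_of_ne_D {s : DyckStep} (h : s ≠ DyckStep.D) : s = DyckStep.U := by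
  cases s <;> simp_all

theorem eastCount_succ_of_D {j : Fin (m + k)} (h : π.1 j = DyckStep.D) :
    eastCount π (j + 1) = eastCount π j + 1 := by
  unfold eastCount
  have : (univ.filter fun l : Fin (m + k) => (l : ℤ) < (j : ℤ) + 1 ∧ π.1 l = DyckStep.D)
      = insert j (univ.filter fun l : Fin (m + k) => (l : ℤ) < j ∧ π.1 l = DyckStep.D) := by
    ext l
    simp only [mem_filter, mem_univ, true_and, mem_insert]
    constructor
    · rintro ⟨h1, h2⟩
      by_cases h3 : l = j
      · exact Or.inl h3
      · right
        refine ⟨?_, h2⟩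
        have : (l : ℕ) ≠ j := fun h => h3 (Fin.ext h)
        omega
    · rintro (rfl | ⟨h1, h2⟩)
      · exact ⟨by omega, h⟩
      · exact ⟨by omega, h2⟩
  rw [this, card_insert_of_notMem (by simp)]
  push_cast
  rfl

theorem eastCount_succ_of_not_D {i : ℤ} (h : ∀ j : Fin (m + k), (j : ℤ) = i → π.1 j ≠ DyckStep.D) :
    eastCount π (i + 1) = eastCount π i := by
  unfold eastCount
  congr 2
  ext l
  simp only [mem_filter, mem_univ, true_and]
  constructor
  · rintro ⟨h1, h2⟩
    refine ⟨?_, h2⟩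
    by_contra h3
    exact h l (by omega) h2
  · rintro ⟨h1, h2⟩
    exact ⟨by omega, h2⟩

theorem eastCount_succ_of_U {j : Fin (m + k)} (h : π.1 j = DyckStep.U) :
    eastCount π (j + 1) = eastCount π j := by
  apply eastCount_succ_of_not_D
  intro l hl
  have : l = j := Fin.ext (by omega)
  rw [this, h]
  simp

theorem eastCount_step (i : ℤ) :
    eastCount π (i + 1) = eastCount π i ∨
      (eastCount π (i + 1) = eastCount π i + 1 ∧
        ∃ j : Fin (m + k), (j : ℤ) = i ∧ π.1 j = DyckStep.D) := by
  by_cases h : ∃ j : Fin (m + k), (j : ℤ) = i ∧ π.1 j = DyckStep.D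
  · obtain ⟨j, rfl, hj⟩ := h
    exact Or.inr ⟨eastCount_succ_of_D π hj, j, rfl, hj⟩
  · push Not at h
    exact Or.inl (eastCount_succ_of_not_D π h)

theorem eastCount_mono : Monotone (eastCount π) :=
  monotone_int_of_le_succ fun i => by rcases eastCount_step π i with h | ⟨h, -⟩ <;> omega

theorem eastCount_sub_le {i j : ℤ} (h : i ≤ j) : eastCount π j - eastCount π i ≤ j - i := by
  have : Monotone fun l => l - eastCount π l := monotone_int_of_le_succ fun i => by
    rcases eastCount_step π i with h | ⟨h, -⟩ <;> omega
  have := this h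
  simp only at this
  omega

theorem eastCount_of_nonpos {i : ℤ} (h : i ≤ 0) : eastCount π i = 0 := by
  simp only [eastCount, Nat.cast_eq_zero, card_eq_zero, filter_eq_empty_iff]
  rintro j - ⟨h1, -⟩
  omega

theorem eastCount_of_ge {i : ℤ} (h : (m + k : ℤ) ≤ i) : eastCount π i = k := by
  have h1 := Finset.card_filter_add_card_filter_not (s := (univ : Finset (Fin (m + k))))
    (fun j => π.1 j = DyckStep.U)
  rw [π.2, card_univ, Fintype.card_fin] at h1
  have h2 : (univ.filter fun j : Fin (m + k) => (j : ℤ) < i ∧ π.1 j = DyckStep.D)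
      = univ.filter fun j => ¬ π.1 j = DyckStep.U := by
    ext j
    simp only [mem_filter, mem_univ, true_and]
    constructor
    · rintro ⟨-, h⟩
      simp [h]
    · intro h
      refine ⟨by have := j.2; omega, ?_⟩
      cases hj : π.1 j <;> simp_all
  unfold eastCount
  rw [h2]
  omega

theorem eastCount_le (i : ℤ) : eastCount π i ≤ k := by
  rw [← eastCount_of_ge π (le_max_right i (m + k : ℤ))]
  exact eastCount_mono π (le_max_left _ _)

theorem eastCount_nonneg (i : ℤ) : 0 ≤ eastCount π i := by simp [eastCount]

theorem eastCount_le_self {i : ℤ} (h : 0 ≤ i) : eastCount π i ≤ i := by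
  have := eastCount_sub_le π h
  rw [eastCount_of_nonpos π le_rfl] at this
  omega

theorem sub_eastCount_le {i : ℤ} (h : i ≤ m + k) : i - eastCount π i ≤ m := by
  have := eastCount_sub_le π h
  rw [eastCount_of_ge π le_rfl] at this
  omega

theorem countBefore_D (i : Fin (m + k)) :
    (countBefore π DyckStep.D i : ℤ) = eastCount π i := by
  simp [countBefore, eastCount]

theorem countBefore_U (i : Fin (m + k)) :
    (countBefore π DyckStep.U i : ℤ) = i - eastCount π i := by
  have h := Finset.card_filter_add_card_filter_not (s := univ.filter fun j : Fin (m + k) => j < i)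
    (fun j => π.1 j = DyckStep.U)
  have h1 : (univ.filter fun j : Fin (m + k) => j < i).card = i := by
    rw [← Fin.card_Iio i]
    congr 1
    ext j
    simp
  rw [h1, filter_filter, filter_filter] at h
  have h2 : (univ.filter fun j : Fin (m + k) => (j : ℤ) < (i : ℤ) ∧ π.1 j = DyckStep.D)
      = univ.filter fun j => j < i ∧ ¬ π.1 j = DyckStep.U := by
    ext j
    simp only [mem_filter, mem_univ, true_and]
    refine and_congr (by simp) ?_
    cases π.1 j <;> simp
  simp only [countBefore, eastCount]
  rw [h2]
  omega

/-- A box is above the path iff it is to the left of the point of the path on its antidiagonal. -/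
theorem mem_young {c : ℤ × ℤ} :
    c ∈ young π ↔ (0 ≤ c.1 ∧ c.1 < k) ∧ (0 ≤ c.2 ∧ c.2 < m) ∧
      c.1 < eastCount π (c.1 + c.2 + 1) := by
  simp only [young, mem_filter, mem_product, mem_Ico, and_assoc]
  refine and_congr_right fun h1 => and_congr_right fun h2 => and_congr_right fun h3 =>
    and_congr_right fun h4 => ?_
  simp only [countBefore_D, countBefore_U]
  constructor
  · rintro ⟨i, hi, hx, hy⟩
    have := eastCount_succ_of_D π hi
    have : eastCount π (i + 1) ≤ eastCount π (c.1 + c.2 + 1) := eastCount_mono π (by omega)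
    omega
  · -- the east step in the column of `c` is the last place where the count is at most `c.1`
    intro h
    have key : ∀ n : ℕ, c.1 < eastCount π n →
        ∃ i : Fin (m + k), π.1 i = DyckStep.D ∧ eastCount π i = c.1 ∧ (i : ℤ) + 1 ≤ n := by
      intro n
      induction n with
      | zero =>
        intro h
        rw [Nat.cast_zero, eastCount_of_nonpos π le_rfl] at h
        omega
      | succ n ih =>
        intro h
        by_cases hn : c.1 < eastCount π n
        · obtain ⟨i, hi, h5, h6⟩ := ih hn
          exact ⟨i, hi, h5, by push_cast; omega⟩
        · push_cast at h
          rcases eastCount_step π n with h5 | ⟨h5, j, hj, hD⟩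
          · omega
          · exact ⟨j, hD, by rw [hj]; omega, by push_cast; omega⟩
    obtain ⟨n, hn⟩ : ∃ n : ℕ, (n : ℤ) = c.1 + c.2 + 1 := ⟨(c.1 + c.2 + 1).toNat, by omega⟩
    rw [← hn] at h
    obtain ⟨i, hi, h5, h6⟩ := key n h
    exact ⟨i, hi, h5, by omega⟩

variable (lam mu : LatticePath m k)

/-- To the right of a path the boundary of the rectangle plays no role. -/
theorem boxAt_mem_young_of_le {i x : ℤ} (h : eastCount mu i ≤ x) :
    boxAt i x ∈ young lam ↔ x < eastCount lam i := by
  rw [mem_young]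
  simp only [boxAt]
  rw [show x + (i - 1 - x) + 1 = i by ring]
  constructor
  · exact fun h => h.2.2
  · intro h1
    have h2 := eastCount_nonneg mu i
    have h3 := eastCount_le lam i
    have h4 : 0 < i := by
      by_contra h5
      rw [eastCount_of_nonpos lam (by omega)] at h1
      omega
    have h5 : i < m + k := by
      by_contra h5
      rw [eastCount_of_ge mu (by omega)] at h
      omega
    have h6 := eastCount_le_self lam h4.le
    have h7 := sub_eastCount_le mu h5.le
    refine ⟨⟨by omega, by omega⟩, ⟨by omega, by omega⟩, h1⟩

theorem boxAt_mem_young_sdiff {i x : ℤ} :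
    boxAt i x ∈ young lam \ young mu ↔ eastCount mu i ≤ x ∧ x < eastCount lam i := by
  rw [mem_sdiff]
  constructor
  · rintro ⟨h1, h2⟩
    rw [mem_young] at h1 h2
    have h3 : (boxAt i x).1 + (boxAt i x).2 + 1 = i := by simp [boxAt]
    rw [h3] at h1 h2
    refine ⟨?_, h1.2.2⟩
    by_contra h4
    exact h2 ⟨h1.1, h1.2.1, by simp only [boxAt]; omega⟩
  · rintro ⟨h1, h2⟩
    refine ⟨(boxAt_mem_young_of_le lam mu h1).2 h2, fun h => ?_⟩
    rw [boxAt_mem_young_of_le mu mu h1] at h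
    omega

theorem young_subset_iff : young mu ⊆ young lam ↔ ∀ i, eastCount mu i ≤ eastCount lam i := by
  constructor
  · intro h i
    by_contra hi
    have h1 : boxAt i (eastCount lam i) ∈ young mu \ young lam :=
      (boxAt_mem_young_sdiff mu lam).2 ⟨le_rfl, by omega⟩
    rw [mem_sdiff] at h1
    exact h1.2 (h h1.1)
  · intro h c hc
    by_contra hc'
    obtain ⟨i, x, rfl⟩ := exists_eq_boxAt c
    have := (boxAt_mem_young_sdiff mu lam).1 (mem_sdiff.2 ⟨hc, hc'⟩)
    have := h i
    omega

theorem eastCount_injective {lam mu : LatticePath m k}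
    (h : ∀ i, eastCount lam i = eastCount mu i) : lam = mu := by
  apply Subtype.ext
  funext j
  have h0 := h j
  have h1 := h (j + 1)
  cases h2 : lam.1 j <;> cases h3 : mu.1 j <;> first | rfl | skip
  · rw [eastCount_succ_of_U lam h2, eastCount_succ_of_D mu h3] at h1
    omega
  · rw [eastCount_succ_of_D lam h2, eastCount_succ_of_U mu h3] at h1
    omega

end Counting

/-! ### Tiles -/

/-- The level of the point on the antidiagonal `i` in column `x`: north steps raise it by `b`,
east steps lower it by `a`. -/
def level (a b : ℕ) (i x : ℤ) : ℤ := b * i - (a + b) * x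

section Level

variable {a b : ℕ}

theorem level_succ (i x : ℤ) : level a b (i + 1) x = level a b i x + b := by
  unfold level; ring

theorem level_succ_succ (i x : ℤ) : level a b (i + 1) (x + 1) = level a b i x - a := by
  unfold level; ring

theorem level_pred (i x : ℤ) : level a b i (x - 1) = level a b i x + (a + b) := by
  unfold level; ring

theorem level_le_level (ha : 0 < a) {i x y : ℤ} :
    level a b i x ≤ level a b i y ↔ y ≤ x := by
  have : (0 : ℤ) < a + b := by positivity
  unfold level
  rw [sub_le_sub_iff_left, mul_le_mul_iff_right₀ this]

end Level

/-- A word along which the level returns to its initial value and never goes below it. All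
enlarged Dyck paths are of this kind, and nothing else about them is used. -/
def IsBallot (a b : ℕ) (w : List DyckStep) : Prop :=
  b * w.count DyckStep.U = a * w.count DyckStep.D ∧
    ∀ n, a * (w.take n).count DyckStep.D ≤ b * (w.take n).count DyckStep.U

theorem count_U_add_count_D (w : List DyckStep) :
    w.count DyckStep.U + w.count DyckStep.D = w.length := by
  induction w with
  | nil => rfl
  | cons s w ih => cases s <;> simp <;> omega

theorem enlarge_count (a b : ℕ) (p : List DyckStep) :
    (enlarge a b p).count DyckStep.U = a * p.count DyckStep.U ∧
      (enlarge a b p).count DyckStep.D = b * p.count DyckStep.D := by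
  induction p with
  | nil => simp [enlarge]
  | cons s p ih =>
    have h : enlarge a b (s :: p) = enlarge a b [s] ++ enlarge a b p := by simp [enlarge]
    rw [h, List.count_append, List.count_append, ih.1, ih.2]
    cases s <;> simp [enlarge, List.count_replicate] <;> ring

/-- The ballot condition passes to the enlarged word; the slack `c` is what the letters before
`p` contribute. -/
theorem enlarge_take_count (a b : ℕ) (p : List DyckStep) : ∀ c : ℕ,
    (∀ n, (p.take n).count DyckStep.D ≤ (p.take n).count DyckStep.U + c) →
    ∀ n, a * ((enlarge a b p).take n).count DyckStep.D
      ≤ b * ((enlarge a b p).take n).count DyckStep.U + a * b * c := by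
  induction p with
  | nil => intro c _ n; simp [enlarge]
  | cons s p ih =>
    intro c hc n
    have h : enlarge a b (s :: p) = enlarge a b [s] ++ enlarge a b p := by simp [enlarge]
    rw [h, List.take_append, List.count_append, List.count_append]
    cases s with
    | U =>
      have h1 : ∀ n, (p.take n).count DyckStep.D ≤ (p.take n).count DyckStep.U + (c + 1) := by
        intro n
        have := hc (n + 1)
        simp at this
        omega
      have h2 := ih (c + 1) h1 (n - (enlarge a b [DyckStep.U]).length)
      simp only [enlarge, List.flatMap_cons, List.flatMap_nil, List.append_nil,
        List.length_replicate, List.take_replicate, List.count_replicate] at h2 ⊢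
      simp only [beq_self_eq_true, if_true, reduceCtorEq, beq_iff_eq, if_false]
      by_cases hn : n ≤ a
      · simp [Nat.sub_eq_zero_of_le hn]
      · rw [min_eq_right (by omega)]
        nlinarith
    | D =>
      obtain ⟨c, rfl⟩ : ∃ c', c = c' + 1 := by
        have := hc 1
        simp at this
        exact ⟨c - 1, by omega⟩
      have h1 : ∀ n, (p.take n).count DyckStep.D ≤ (p.take n).count DyckStep.U + c := by
        intro n
        have := hc (n + 1)
        simp at this
        omega
      have h2 := ih c h1 (n - (enlarge a b [DyckStep.D]).length)
      simp only [enlarge, List.flatMap_cons, List.flatMap_nil, List.append_nil,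
        List.length_replicate, List.take_replicate, List.count_replicate] at h2 ⊢
      simp only [beq_self_eq_true, if_true, reduceCtorEq, beq_iff_eq, if_false]
      have h3 : a * min n b ≤ a * b := Nat.mul_le_mul_left a (min_le_right _ _)
      nlinarith

theorem isBallot_of_mem_enlargedPaths {a b : ℕ} {w : List DyckStep}
    (h : w ∈ enlargedPaths a b) : IsBallot a b w := by
  obtain ⟨p, rfl⟩ := h
  constructor
  · rw [(enlarge_count a b _).1, (enlarge_count a b _).2, p.count_U_eq_count_D]
    ring
  · intro n
    simpa using enlarge_take_count a b p.toList 0 (fun n => by simpa using p.count_D_le_count_U n) n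

theorem boxAt_succ (i x : ℤ) : boxAt (i + 1) x = ((boxAt i x).1, (boxAt i x).2 + 1) := by
  ext <;> simp only [boxAt]; ring

theorem boxAt_succ_succ (i x : ℤ) :
    boxAt (i + 1) (x + 1) = ((boxAt i x).1 + 1, (boxAt i x).2) := by
  ext <;> simp only [boxAt]; ring

theorem boxAt_mem_pathBoxes (w : List DyckStep) : ∀ s x₀ i x : ℤ,
    boxAt i x ∈ pathBoxes (boxAt s x₀) w ↔
      (s ≤ i ∧ i ≤ s + w.length) ∧ x = x₀ + (w.take (i - s).toNat).count DyckStep.D := by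
  induction w with
  | nil =>
    intro s x₀ i x
    simp [pathBoxes, boxAt]
    omega
  | cons c w ih =>
    intro s x₀ i x
    have h0 : boxAt i x = boxAt s x₀ ↔ i = s ∧ x = x₀ := by
      simp [boxAt]
      omega
    have h1 : i ≠ s → s ≤ i → (i - s).toNat = (i - (s + 1)).toNat + 1 := by omega
    cases c with
    | U =>
      have h2 : pathBoxes (boxAt s x₀) (DyckStep.U :: w)
          = insert (boxAt s x₀) (pathBoxes (boxAt (s + 1) x₀) w) := by
        rw [boxAt_succ]
        rfl
      rw [h2, mem_insert, ih, h0]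
      by_cases hi : i = s
      · subst hi; simp; omega
      · by_cases hs : s ≤ i
        · rw [h1 hi hs]
          simp [hi]
          omega
        · simp [hi]
          omega
    | D =>
      have h2 : pathBoxes (boxAt s x₀) (DyckStep.D :: w)
          = insert (boxAt s x₀) (pathBoxes (boxAt (s + 1) (x₀ + 1)) w) := by
        rw [boxAt_succ_succ]
        rfl
      rw [h2, mem_insert, ih, h0]
      by_cases hi : i = s
      · subst hi; simp; omega
      · by_cases hs : s ≤ i
        · rw [h1 hi hs]
          simp [hi]
          omega
        · simp [hi]
          omega

theorem card_pathBoxes (w : List DyckStep) : ∀ c, (pathBoxes c w).card = w.length + 1 := by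
  induction w with
  | nil => intro c; simp [pathBoxes]
  | cons s w ih =>
    intro c
    -- the first box lies on an earlier antidiagonal than all others
    have h : ∀ s x₀ x₁ : ℤ, boxAt s x₀ ∉ pathBoxes (boxAt (s + 1) x₁) w := by
      intro s x₀ x₁ h
      rw [boxAt_mem_pathBoxes] at h
      omega
    obtain ⟨i, x, rfl⟩ := exists_eq_boxAt c
    cases s with
    | U =>
      rw [pathBoxes, card_insert_of_notMem, ih, List.length_cons]
      rw [← boxAt_succ]
      exact h i x x
    | D =>
      rw [pathBoxes, card_insert_of_notMem, ih, List.length_cons]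
      rw [← boxAt_succ_succ]
      exact h i x (x + 1)

/-- `d` is a tile with path in `S` that occupies the antidiagonals `s, …, t`, its box on the
antidiagonal `i` being in column `g i`. -/
structure IsTileOn (S : Set (List DyckStep)) (d : Finset (ℤ × ℤ)) (s t : ℤ) (g : ℤ → ℤ) :
    Prop where
  le : s ≤ t
  mem_iff : ∀ i x, boxAt i x ∈ d ↔ (s ≤ i ∧ i ≤ t) ∧ x = g i
  word : ∃ w ∈ S, (w.length : ℤ) = t - s ∧
    ∀ n : ℕ, n ≤ w.length → g (s + n) = g s + (w.take n).count DyckStep.D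

theorem isTileOn_pathBoxes {S : Set (List DyckStep)} {w : List DyckStep} (hw : w ∈ S) (s x : ℤ) :
    IsTileOn S (pathBoxes (boxAt s x) w) s (s + w.length)
      (fun i => x + (w.take (i - s).toNat).count DyckStep.D) where
  le := by omega
  mem_iff := boxAt_mem_pathBoxes w s x
  word := ⟨w, hw, by ring, fun n _ => by simp⟩

theorem IsDyckTile.exists_isTileOn {S : Set (List DyckStep)} {d : Finset (ℤ × ℤ)}
    (h : IsDyckTile S d) : ∃ s t g, IsTileOn S d s t g := by
  obtain ⟨w, hw, c, rfl⟩ := h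
  rw [eq_boxAt c]
  exact ⟨_, _, _, isTileOn_pathBoxes hw _ _⟩

namespace IsTileOn

variable {S : Set (List DyckStep)} {d : Finset (ℤ × ℤ)} {s t : ℤ} {g : ℤ → ℤ}

theorem mem (h : IsTileOn S d s t g) {i : ℤ} (h1 : s ≤ i) (h2 : i ≤ t) : boxAt i (g i) ∈ d :=
  (h.mem_iff i _).2 ⟨⟨h1, h2⟩, rfl⟩

theorem step (h : IsTileOn S d s t g) {i : ℤ} (h1 : s ≤ i) (h2 : i < t) :
    g (i + 1) = g i ∨ g (i + 1) = g i + 1 := by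
  obtain ⟨w, -, hl, hw⟩ := h.word
  obtain ⟨n, rfl⟩ : ∃ n : ℕ, i = s + n := ⟨(i - s).toNat, by omega⟩
  have h3 : n < w.length := by omega
  have h4 := hw (n + 1) (by omega)
  have h5 := hw n (by omega)
  rw [List.take_succ_eq_append_getElem h3, List.count_append] at h4
  push_cast at h4
  rw [← add_assoc] at h4
  have h6 : List.count DyckStep.D [w[n]] ≤ 1 := List.count_le_length
  omega

theorem level_eq {a b : ℕ} (hS : ∀ w ∈ S, IsBallot a b w) (h : IsTileOn S d s t g) :
    level a b t (g t) = level a b s (g s) := by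
  obtain ⟨w, hwS, hl, hw⟩ := h.word
  have h1 := hw w.length le_rfl
  rw [show s + (w.length : ℤ) = t by omega, List.take_length] at h1
  have h2 : (b : ℤ) * w.count DyckStep.U = a * w.count DyckStep.D := mod_cast (hS w hwS).1
  have h3 : (w.count DyckStep.U : ℤ) + w.count DyckStep.D = t - s := by
    rw [← hl]; exact mod_cast count_U_add_count_D w
  rw [h1, level, level]
  linear_combination h2 - b * h3

theorem level_le {a b : ℕ} (hS : ∀ w ∈ S, IsBallot a b w) (h : IsTileOn S d s t g) {i : ℤ}
    (h1 : s ≤ i) (h2 : i ≤ t) : level a b s (g s) ≤ level a b i (g i) := by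
  obtain ⟨w, hwS, hl, hw⟩ := h.word
  obtain ⟨n, rfl⟩ : ∃ n : ℕ, i = s + n := ⟨(i - s).toNat, by omega⟩
  have h3 := hw n (by omega)
  have h4 : (a : ℤ) * (w.take n).count DyckStep.D ≤ b * (w.take n).count DyckStep.U :=
    mod_cast (hS w hwS).2 n
  have h5 : ((w.take n).count DyckStep.U : ℤ) + (w.take n).count DyckStep.D = n := by
    have := count_U_add_count_D (w.take n)
    rw [List.length_take, min_eq_left (by omega)] at this
    exact mod_cast this
  rw [h3, level, level]
  linear_combination h4 + b * h5

end IsTileOn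

/-! ### Admissible pairs -/

section Admissible

variable {m k : ℕ}

theorem length_between (π : LatticePath m k) (i j : Fin (m + k)) :
    (between π i j).length = (j : ℕ) - (i + 1) := by
  have := j.2
  rw [between, List.length_take, List.length_drop, List.length_ofFn]
  omega

theorem between_congr {π ρ : LatticePath m k} {i j : Fin (m + k)}
    (h : ∀ l, i < l → l < j → ρ.1 l = π.1 l) : between ρ i j = between π i j := by
  apply List.ext_getElem
  · rw [length_between, length_between]
  · intro n h1 h2
    rw [length_between] at h1
    simp only [between, List.getElem_take, List.getElem_drop, List.getElem_ofFn]
    exact h _ (by rw [Fin.lt_def]; simp only; omega) (by rw [Fin.lt_def]; simp only; omega)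

theorem eastCount_between (π : LatticePath m k) (i j : Fin (m + k)) (n : ℕ)
    (hn : n ≤ (between π i j).length) :
    eastCount π (i + 1 + n) =
      eastCount π (i + 1) + ((between π i j).take n).count DyckStep.D := by
  induction n with
  | zero => simp
  | succ n ih =>
    have hn' := hn
    rw [length_between] at hn'
    have hj := j.2
    have hl : (i : ℕ) + 1 + n < m + k := by omega
    have h1 : (between π i j)[n] = π.1 ⟨i + 1 + n, hl⟩ := by
      simp [between]
    rw [List.take_succ_eq_append_getElem hn, List.count_append, h1, Nat.cast_add
      (List.count _ _), ← add_assoc (eastCount _ _), ← ih (by omega), Nat.cast_succ, ← add_assoc]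
    have h2 : ((i : ℤ) + 1 + n) = ((⟨i + 1 + n, hl⟩ : Fin (m + k)) : ℤ) := by simp
    cases h3 : π.1 ⟨i + 1 + n, hl⟩ with
    | U => rw [h2, eastCount_succ_of_U π h3]; simp
    | D => rw [h2, eastCount_succ_of_D π h3]; simp

variable {a b : ℕ} {S : Set (List DyckStep)} {π : LatticePath m k}

theorem mem_admissiblePairs {f : Fin (m + k) × Fin (m + k)} :
    f ∈ admissiblePairs S π ↔ f.1 < f.2 ∧ π.1 f.1 = DyckStep.U ∧ π.1 f.2 = DyckStep.D ∧
      between π f.1 f.2 ∈ S := by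
  simp [admissiblePairs, IsAdmissible]

theorem level_of_U {j : Fin (m + k)} (h : π.1 j = DyckStep.U) :
    level a b (j + 1) (eastCount π (j + 1)) = level a b j (eastCount π j) + b := by
  rw [eastCount_succ_of_U π h, level_succ]

theorem level_of_D {j : Fin (m + k)} (h : π.1 j = DyckStep.D) :
    level a b (j + 1) (eastCount π (j + 1)) = level a b j (eastCount π j) - a := by
  rw [eastCount_succ_of_D π h, level_succ_succ]

/-- A path whose letters strictly between `i` and `j` form a word of `S` runs through the centers
of a tile there. -/
theorem isTileOn_between (ρ : LatticePath m k) {i j : Fin (m + k)} (hij : i < j)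
    (h : between ρ i j ∈ S) :
    IsTileOn S (pathBoxes (boxAt (i + 1) (eastCount ρ (i + 1))) (between ρ i j)) (i + 1) j
      (eastCount ρ) := by
  have hl : ((between ρ i j).length : ℤ) = j - (i + 1) := by
    have := Fin.lt_def.1 hij
    rw [length_between]; omega
  refine ⟨by omega, fun l x => ?_, ⟨_, h, hl, eastCount_between ρ i j⟩⟩
  rw [boxAt_mem_pathBoxes, hl]
  rw [add_sub_cancel]
  refine and_congr_right fun ⟨h1, h2⟩ => ?_
  rw [← eastCount_between ρ i j _ (by omega), show (i : ℤ) + 1 + (l - (i + 1)).toNat = l by omega]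

theorem admissible_level_le (hS : ∀ w ∈ S, IsBallot a b w)
    {f : Fin (m + k) × Fin (m + k)} (hf : f ∈ admissiblePairs S π) {l : ℤ}
    (h1 : f.1 + 1 ≤ l) (h2 : l ≤ f.2) :
    level a b (f.1 + 1) (eastCount π (f.1 + 1)) ≤ level a b l (eastCount π l) := by
  rw [mem_admissiblePairs] at hf
  exact (isTileOn_between π hf.1 hf.2.2.2).level_le hS h1 h2

theorem admissible_level_eq (hS : ∀ w ∈ S, IsBallot a b w)
    {f : Fin (m + k) × Fin (m + k)} (hf : f ∈ admissiblePairs S π) :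
    level a b f.2 (eastCount π f.2) = level a b (f.1 + 1) (eastCount π (f.1 + 1)) := by
  rw [mem_admissiblePairs] at hf
  exact (isTileOn_between π hf.1 hf.2.2.2).level_eq hS

/-- Two admissible pairs have no common position, and they do not cross. -/
theorem admissible_left_lt (ha : 0 < a) (hb : 0 < b) (hS : ∀ w ∈ S, IsBallot a b w)
    {f g : Fin (m + k) × Fin (m + k)} (hf : f ∈ admissiblePairs S π)
    (hg : g ∈ admissiblePairs S π) (h : f.1 < g.1) : f.2 < g.1 ∨ g.2 < f.2 := by
  by_contra! hc
  obtain ⟨hc1, hc2⟩ := hc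
  have hf' := mem_admissiblePairs.1 hf
  have hg' := mem_admissiblePairs.1 hg
  have hne : g.1 ≠ f.2 := fun h => by simp [h, hf'.2.2.1] at hg'
  have h1 := Fin.lt_def.1 h
  have h2 := Fin.lt_def.1 (lt_of_le_of_ne hc1 hne)
  have h3 := Fin.le_def.1 hc2
  have h4 := level_of_U (a := a) (b := b) hg'.2.1
  have h5 := level_of_D (a := a) (b := b) hf'.2.2.1
  have h6 := admissible_level_le hS hf (l := g.1) (by omega) (by omega)
  have h7 := admissible_level_eq hS hf
  have h8 := admissible_level_eq hS hg
  rcases h3.eq_or_lt with h3 | h3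
  · rw [← h3] at h8
    omega
  · have h9 := admissible_level_le hS hg (l := f.2 + 1) (by omega) (by omega)
    omega

theorem admissible_eq_of_left_eq (ha : 0 < a) (hS : ∀ w ∈ S, IsBallot a b w)
    {f g : Fin (m + k) × Fin (m + k)} (hf : f ∈ admissiblePairs S π)
    (hg : g ∈ admissiblePairs S π) (h : f.1 = g.1) : f = g := by
  have aux : ∀ f g : Fin (m + k) × Fin (m + k), f ∈ admissiblePairs S π →
      g ∈ admissiblePairs S π → f.1 = g.1 → ¬ f.2 < g.2 := by
    intro f g hf hg h hlt
    have hf' := mem_admissiblePairs.1 hf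
    have h1 := Fin.lt_def.1 hlt
    have h2 := Fin.lt_def.1 hf'.1
    have h5 := level_of_D (a := a) (b := b) hf'.2.2.1
    have h7 := admissible_level_eq hS hf
    have h9 := admissible_level_le hS hg (l := f.2 + 1) (by rw [← h]; omega) (by omega)
    rw [← h] at h9
    omega
  exact Prod.ext h (le_antisymm (not_lt.1 (aux g f hg hf h.symm)) (not_lt.1 (aux f g hf hg h)))

theorem admissible_trichotomy (ha : 0 < a) (hb : 0 < b) (hS : ∀ w ∈ S, IsBallot a b w)
    {f g : Fin (m + k) × Fin (m + k)} (hf : f ∈ admissiblePairs S π)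
    (hg : g ∈ admissiblePairs S π) (h : f ≠ g) :
    (f.2 < g.1 ∨ g.2 < f.1) ∨ (f.1 < g.1 ∧ g.2 < f.2) ∨ (g.1 < f.1 ∧ f.2 < g.2) := by
  rcases lt_trichotomy f.1 g.1 with h1 | h1 | h1
  · have := admissible_left_lt ha hb hS hf hg h1
    tauto
  · exact absurd (admissible_eq_of_left_eq ha hS hf hg h1) h
  · have := admissible_left_lt ha hb hS hg hf h1
    tauto

theorem admissible_eq_of_right_eq (ha : 0 < a) (hb : 0 < b) (hS : ∀ w ∈ S, IsBallot a b w)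
    {f g : Fin (m + k) × Fin (m + k)} (hf : f ∈ admissiblePairs S π)
    (hg : g ∈ admissiblePairs S π) (h : f.2 = g.2) : f = g := by
  by_contra hne
  have h1 := (mem_admissiblePairs.1 hf).1
  have h2 := (mem_admissiblePairs.1 hg).1
  have := admissible_trichotomy ha hb hS hf hg hne
  rw [h] at this h1
  rcases this with (h3 | h3) | h3 | h3
  · exact lt_asymm h3 h2
  · exact lt_asymm h3 h1
  · exact lt_irrefl _ h3.2
  · exact lt_irrefl _ h3.2

/-! ### Flips -/

section FlipPairs

variable {F : Finset (Fin (m + k) × Fin (m + k))} {ρ : LatticePath m k}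

theorem flip_apply_fst (hflip : flipPairs π F = ρ.1) {f : Fin (m + k) × Fin (m + k)}
    (hf : f ∈ F) : ρ.1 f.1 = DyckStep.D := by
  rw [← hflip, flipPairs, if_pos ⟨f, hf, rfl⟩]

theorem flip_apply_snd (hF : F ⊆ admissiblePairs S π) (hflip : flipPairs π F = ρ.1)
    {f : Fin (m + k) × Fin (m + k)} (hf : f ∈ F) : ρ.1 f.2 = DyckStep.U := by
  rw [← hflip, flipPairs, if_neg, if_pos ⟨f, hf, rfl⟩]
  rintro ⟨g, hg, h⟩
  have h1 := (mem_admissiblePairs.1 (hF hg)).2.1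
  have h2 := (mem_admissiblePairs.1 (hF hf)).2.2.1
  rw [h, h2] at h1
  cases h1

theorem flip_apply_of_ne (hflip : flipPairs π F = ρ.1) {x : Fin (m + k)}
    (h : ∀ f ∈ F, f.1 ≠ x ∧ f.2 ≠ x) : ρ.1 x = π.1 x := by
  rw [← hflip, flipPairs, if_neg, if_neg]
  · rintro ⟨f, hf, h1⟩
    exact (h f hf).2 h1
  · rintro ⟨f, hf, h1⟩
    exact (h f hf).1 h1

theorem flip_apply_of_notMem (ha : 0 < a) (hb : 0 < b) (hS : ∀ w ∈ S, IsBallot a b w)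
    (hF : F ⊆ admissiblePairs S π) (hflip : flipPairs π F = ρ.1)
    {f : Fin (m + k) × Fin (m + k)} (hf : f ∈ admissiblePairs S π) (hfF : f ∉ F) :
    ρ.1 f.1 = DyckStep.U ∧ ρ.1 f.2 = DyckStep.D := by
  have h := mem_admissiblePairs.1 hf
  constructor
  · rw [flip_apply_of_ne hflip, h.2.1]
    refine fun g hg => ⟨fun h1 => hfF ?_, fun h1 => ?_⟩
    · rwa [← admissible_eq_of_left_eq ha hS (hF hg) hf h1]
    · have h2 := (mem_admissiblePairs.1 (hF hg)).2.2.1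
      rw [h1, h.2.1] at h2
      cases h2
  · rw [flip_apply_of_ne hflip, h.2.2.1]
    refine fun g hg => ⟨fun h1 => ?_, fun h1 => hfF ?_⟩
    · have h2 := (mem_admissiblePairs.1 (hF hg)).2.1
      rw [h1, h.2.2.1] at h2
      cases h2
    · rwa [← admissible_eq_of_right_eq ha hb hS (hF hg) hf h1]

end FlipPairs

/-- The path `ρ` with the letters at the two positions of `f` exchanged. -/
def swapPath (ρ : LatticePath m k) (f : Fin (m + k) × Fin (m + k)) : LatticePath m k :=
  ⟨ρ.1 ∘ Equiv.swap f.1 f.2, by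
    refine (Finset.card_equiv (Equiv.swap f.1 f.2) fun i => ?_).trans ρ.2
    simp⟩

theorem swapPath_swapPath (ρ : LatticePath m k) (f : Fin (m + k) × Fin (m + k)) :
    swapPath (swapPath ρ f) f = ρ := by
  apply Subtype.ext
  funext i
  simp [swapPath]

theorem swapPath_fst (ρ : LatticePath m k) (f : Fin (m + k) × Fin (m + k)) :
    (swapPath ρ f).1 f.1 = ρ.1 f.2 := by
  simp [swapPath]

theorem swapPath_snd (ρ : LatticePath m k) (f : Fin (m + k) × Fin (m + k)) :
    (swapPath ρ f).1 f.2 = ρ.1 f.1 := by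
  simp [swapPath]

theorem swapPath_of_ne (ρ : LatticePath m k) {f : Fin (m + k) × Fin (m + k)} {x : Fin (m + k)}
    (h1 : x ≠ f.1) (h2 : x ≠ f.2) : (swapPath ρ f).1 x = ρ.1 x := by
  simp [swapPath, Equiv.swap_apply_of_ne_of_ne h1 h2]

theorem eastCount_swapPath (ρ : LatticePath m k) {f : Fin (m + k) × Fin (m + k)} (hf : f.1 < f.2)
    (hU : ρ.1 f.1 = DyckStep.U) (hD : ρ.1 f.2 = DyckStep.D) (l : ℤ) :
    eastCount (swapPath ρ f) l = eastCount ρ l + if f.1 < l ∧ l ≤ f.2 then 1 else 0 := by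
  have hf' := Fin.lt_def.1 hf
  have key : ∀ n : ℕ, eastCount (swapPath ρ f) n =
      eastCount ρ n + if (f.1 : ℤ) < n ∧ (n : ℤ) ≤ f.2 then 1 else 0 := by
    intro n
    induction n with
    | zero =>
      rw [Nat.cast_zero, eastCount_of_nonpos _ le_rfl, eastCount_of_nonpos _ le_rfl, if_neg] <;>
        omega
    | succ n ih =>
      by_cases hn : n < m + k
      · obtain ⟨j, hj⟩ : ∃ j : Fin (m + k), (j : ℕ) = n := ⟨⟨n, hn⟩, rfl⟩
        subst hj
        push_cast
        by_cases h1 : j = f.1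
        · subst h1
          rw [eastCount_succ_of_D _ (by rw [swapPath_fst, hD]), eastCount_succ_of_U _ hU, ih]
          split_ifs <;> omega
        · by_cases h2 : j = f.2
          · subst h2
            rw [eastCount_succ_of_U _ (by rw [swapPath_snd, hU]), eastCount_succ_of_D _ hD, ih]
            split_ifs <;> omega
          · have h3 := swapPath_of_ne ρ h1 h2
            rw [Fin.ext_iff] at h1 h2
            cases h4 : ρ.1 j with
            | U =>
              rw [eastCount_succ_of_U _ (h3.trans h4), eastCount_succ_of_U _ h4, ih]
              split_ifs <;> omega
            | D =>
              rw [eastCount_succ_of_D _ (h3.trans h4), eastCount_succ_of_D _ h4, ih]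
              split_ifs <;> omega
      · rw [eastCount_of_ge _ (by push_cast; omega), eastCount_of_ge _ (by push_cast; omega),
          if_neg]
        · omega
        · have := f.2.2
          push_cast
          omega
  rcases lt_or_ge l 0 with hl | hl
  · rw [eastCount_of_nonpos _ hl.le, eastCount_of_nonpos _ hl.le, if_neg] <;> omega
  · lift l to ℕ using hl
    exact key l

/-- The boxes between a path and the path obtained by exchanging the letters at the positions
of `f`. The definition is symmetric in the two paths. -/
noncomputable def flipTile (ρ : LatticePath m k) (f : Fin (m + k) × Fin (m + k)) : Finset (ℤ × ℤ) :=
  symmDiff (young ρ) (young (swapPath ρ f))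

theorem flipTile_swapPath (ρ : LatticePath m k) (f : Fin (m + k) × Fin (m + k)) :
    flipTile (swapPath ρ f) f = flipTile ρ f := by
  rw [flipTile, flipTile, swapPath_swapPath, symmDiff_comm]

theorem boxAt_mem_flipTile {ρ : LatticePath m k} {f : Fin (m + k) × Fin (m + k)} (hf : f.1 < f.2)
    (hU : ρ.1 f.1 = DyckStep.U) (hD : ρ.1 f.2 = DyckStep.D) {l x : ℤ} :
    boxAt l x ∈ flipTile ρ f ↔ (f.1 + 1 ≤ l ∧ l ≤ f.2) ∧ x = eastCount ρ l := by
  rw [flipTile, mem_symmDiff, ← mem_sdiff, ← mem_sdiff, boxAt_mem_young_sdiff,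
    boxAt_mem_young_sdiff, eastCount_swapPath ρ hf hU hD]
  split_ifs <;> omega

/-- The tile of a pair that has been flipped borders the path from above. -/
theorem boxAt_mem_flipTile' {ρ : LatticePath m k} {f : Fin (m + k) × Fin (m + k)} (hf : f.1 < f.2)
    (hD : ρ.1 f.1 = DyckStep.D) (hU : ρ.1 f.2 = DyckStep.U) {l x : ℤ} :
    boxAt l x ∈ flipTile ρ f ↔ (f.1 + 1 ≤ l ∧ l ≤ f.2) ∧ x = eastCount ρ l - 1 := by
  have hU' : (swapPath ρ f).1 f.1 = DyckStep.U := by rw [swapPath_fst, hU]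
  have hD' : (swapPath ρ f).1 f.2 = DyckStep.D := by rw [swapPath_snd, hD]
  have h := eastCount_swapPath (swapPath ρ f) hf hU' hD' l
  rw [swapPath_swapPath] at h
  rw [← flipTile_swapPath, boxAt_mem_flipTile hf hU' hD', h]
  split_ifs <;> omega

theorem finset_ext_boxAt {d e : Finset (ℤ × ℤ)} (h : ∀ l x, boxAt l x ∈ d ↔ boxAt l x ∈ e) :
    d = e := by
  ext c
  obtain ⟨l, x, rfl⟩ := exists_eq_boxAt c
  exact h l x

theorem flipTile_eq_pathBoxes {ρ : LatticePath m k} {f : Fin (m + k) × Fin (m + k)}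
    (hf : f.1 < f.2) (hU : ρ.1 f.1 = DyckStep.U) (hD : ρ.1 f.2 = DyckStep.D) :
    flipTile ρ f =
      pathBoxes (boxAt (f.1 + 1) (eastCount ρ (f.1 + 1))) (between ρ f.1 f.2) := by
  apply finset_ext_boxAt
  intro l x
  rw [boxAt_mem_flipTile hf hU hD, (isTileOn_between (S := Set.univ) ρ hf trivial).mem_iff]

end Admissible

/-! ### The upper boundary of a cover-inclusive tiling -/

section Tiling

variable {m k a b : ℕ} {S : Set (List DyckStep)} {lam ρ : LatticePath m k}
  {D : Finset (Finset (ℤ × ℤ))}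

theorem IsDyckTiling.mem_region (hT : IsDyckTiling S lam ρ D) {d : Finset (ℤ × ℤ)} (hd : d ∈ D)
    {i x : ℤ} (h : boxAt i x ∈ d) : eastCount ρ i ≤ x ∧ x < eastCount lam i := by
  rw [← boxAt_mem_young_sdiff, ← hT.2.2.2]
  exact mem_biUnion.2 ⟨d, hd, h⟩

theorem IsDyckTiling.exists_mem (hT : IsDyckTiling S lam ρ D) {i x : ℤ} (h1 : eastCount ρ i ≤ x)
    (h2 : x < eastCount lam i) : ∃ d ∈ D, boxAt i x ∈ d := by
  have h := (boxAt_mem_young_sdiff lam ρ).2 ⟨h1, h2⟩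
  rw [← hT.2.2.2, mem_biUnion] at h
  exact h

theorem IsDyckTiling.eq_of_mem (hT : IsDyckTiling S lam ρ D) {d e : Finset (ℤ × ℤ)} (hd : d ∈ D)
    (he : e ∈ D) {c : ℤ × ℤ} (hcd : c ∈ d) (hce : c ∈ e) : d = e := by
  by_contra h
  exact disjoint_left.1 (hT.2.2.1 d hd e he h) hcd hce

theorem IsDyckTiling.shiftSE_subset (hT : IsDyckTiling S lam ρ D) (hC : IsCoverInclusive lam D)
    {d e : Finset (ℤ × ℤ)} (hd : d ∈ D) (he : e ∈ D) {c : ℤ × ℤ} (hcd : c ∈ d)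
    (hce : c ∈ shiftSE e) : shiftSE e ⊆ d := by
  rcases hC e he with ⟨d₂, hd₂, -, h⟩ | h
  · rwa [hT.eq_of_mem hd hd₂ hcd (h hce)]
  · have h1 : c ∈ D.biUnion id := mem_biUnion.2 ⟨d, hd, hcd⟩
    rw [hT.2.2.2, mem_sdiff] at h1
    exact absurd h1.1 (h c hce)

/-- The level of the first (and last, and lowest) box of a tile. -/
def baseLevel (a b : ℕ) (s : Finset (ℤ × ℤ) → ℤ) (g : Finset (ℤ × ℤ) → ℤ → ℤ)
    (d : Finset (ℤ × ℤ)) : ℤ := level a b (s d) (g d (s d))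

variable {s t : Finset (ℤ × ℤ) → ℤ} {g : Finset (ℤ × ℤ) → ℤ → ℤ}

/-- Over a box of a tile `d` that does not border the upper path there is a tile `e`, which by
cover-inclusiveness spans no more than `d`. -/
theorem exists_tile_above (hT : IsDyckTiling S lam ρ D) (hC : IsCoverInclusive lam D)
    (htile : ∀ d ∈ D, IsTileOn S d (s d) (t d) (g d)) {d : Finset (ℤ × ℤ)} (hd : d ∈ D) {i : ℤ}
    (h1 : s d ≤ i) (h2 : i ≤ t d) (h3 : g d i ≠ eastCount ρ i) :
    ∃ e ∈ D, shiftSE e ⊆ d ∧ (s e ≤ i ∧ i ≤ t e) ∧ (s d ≤ s e ∧ t e ≤ t d) ∧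
      ∀ l, s e ≤ l → l ≤ t e → g e l = g d l - 1 := by
  have hbox := (htile d hd).mem h1 h2
  have h4 := hT.mem_region hd hbox
  obtain ⟨e, he, hbe⟩ := hT.exists_mem (i := i) (x := g d i - 1) (by omega) (by omega)
  have hsub := hT.shiftSE_subset hC hd he hbox (boxAt_mem_shiftSE.2 hbe)
  have h5 : ∀ l, s e ≤ l → l ≤ t e → (s d ≤ l ∧ l ≤ t d) ∧ g e l = g d l - 1 := by
    intro l hl1 hl2
    have h6 : boxAt l (g e l + 1) ∈ d :=
      hsub (boxAt_mem_shiftSE.2 (by rw [add_sub_cancel_right]; exact (htile e he).mem hl1 hl2))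
    rw [(htile d hd).mem_iff] at h6
    exact ⟨h6.1, by omega⟩
  have h6 := (htile e he).le
  exact ⟨e, he, hsub, (((htile e he).mem_iff _ _).1 hbe).1,
    ⟨(h5 _ le_rfl h6).1.1, (h5 _ h6 le_rfl).1.2⟩, fun l hl1 hl2 => (h5 l hl1 hl2).2⟩

theorem baseLevel_lt_of_above (ha : 0 < a) (hS : ∀ w ∈ S, IsBallot a b w)
    (htile : ∀ d ∈ D, IsTileOn S d (s d) (t d) (g d)) {d e : Finset (ℤ × ℤ)} (hd : d ∈ D)
    (he : e ∈ D) (h : s d ≤ s e ∧ t e ≤ t d) (hg : ∀ l, s e ≤ l → l ≤ t e → g e l = g d l - 1) :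
    baseLevel a b s g d < baseLevel a b s g e := by
  have h1 := (htile e he).le
  have h2 := (htile d hd).level_le hS h.1 (h1.trans h.2)
  rw [baseLevel, baseLevel, hg _ le_rfl h1, level_pred]
  omega

/-- If a tile starts at the upper path just after an east step, then another tile ends there, at
a higher level. -/
theorem exists_tile_ending (hS : ∀ w ∈ S, IsBallot a b w) (hT : IsDyckTiling S lam ρ D)
    (htile : ∀ d ∈ D, IsTileOn S d (s d) (t d) (g d)) {d : Finset (ℤ × ℤ)} (hd : d ∈ D)
    (h1 : g d (s d) = eastCount ρ (s d)) (h2 : eastCount ρ (s d) = eastCount ρ (s d - 1) + 1) :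
    ∃ c ∈ D, t c = s d - 1 ∧ baseLevel a b s g c = baseLevel a b s g d + a := by
  have hbox := (htile d hd).mem le_rfl (htile d hd).le
  have h3 := hT.mem_region hd hbox
  have h4 := eastCount_sub_le lam (show s d - 1 ≤ s d by omega)
  obtain ⟨c, hc, hbc⟩ := hT.exists_mem (i := s d - 1) (x := eastCount ρ (s d - 1)) (by omega)
    (by omega)
  obtain ⟨h5, h6⟩ := ((htile c hc).mem_iff _ _).1 hbc
  -- otherwise `c` would also contain the first box of `d`
  have h7 : t c = s d - 1 := by
    by_contra hne
    have hbc' := (htile c hc).mem (i := s d) (by omega) (by omega)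
    have h8 := hT.mem_region hc hbc'
    have h9 := (htile c hc).step h5.1 (by omega)
    rw [sub_add_cancel] at h9
    have h10 : g c (s d) = g d (s d) := by omega
    rw [h10] at hbc'
    have := hT.eq_of_mem hc hd hbc' hbox
    subst this
    omega
  refine ⟨c, hc, h7, ?_⟩
  have h8 := (htile c hc).level_eq hS
  have h9 := level_succ_succ (a := a) (b := b) (s d - 1) (eastCount ρ (s d - 1))
  rw [sub_add_cancel, ← h2] at h9
  rw [baseLevel, ← h8, h7, ← h6, baseLevel, h1, h9]
  ring

/-- If a tile ends at the upper path just before a north step, then another tile starts there, at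
a higher level. -/
theorem exists_tile_starting (hS : ∀ w ∈ S, IsBallot a b w) (hT : IsDyckTiling S lam ρ D)
    (htile : ∀ d ∈ D, IsTileOn S d (s d) (t d) (g d)) {d : Finset (ℤ × ℤ)} (hd : d ∈ D)
    (h1 : g d (t d) = eastCount ρ (t d)) (h2 : eastCount ρ (t d + 1) = eastCount ρ (t d)) :
    ∃ c ∈ D, s c = t d + 1 ∧ baseLevel a b s g c = baseLevel a b s g d + b := by
  have hbox := (htile d hd).mem (htile d hd).le le_rfl
  have h3 := hT.mem_region hd hbox
  have h4 := eastCount_mono lam (show t d ≤ t d + 1 by omega)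
  obtain ⟨c, hc, hbc⟩ := hT.exists_mem (i := t d + 1) (x := eastCount ρ (t d + 1)) le_rfl
    (by omega)
  obtain ⟨h5, h6⟩ := ((htile c hc).mem_iff _ _).1 hbc
  -- otherwise `c` would also contain the last box of `d`
  have h7 : s c = t d + 1 := by
    by_contra hne
    have hbc' := (htile c hc).mem (i := t d) (by omega) (by omega)
    have h8 := hT.mem_region hc hbc'
    have h9 := (htile c hc).step (i := t d) (by omega) (by omega)
    have h10 : g c (t d) = g d (t d) := by omega
    rw [h10] at hbc'
    have := hT.eq_of_mem hc hd hbc' hbox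
    subst this
    omega
  refine ⟨c, hc, h7, ?_⟩
  have h8 := (htile d hd).level_eq hS
  rw [baseLevel, h7, ← h6, h2, level_succ, ← h1, h8, baseLevel]

/-- A tile of highest base level, in a nonempty set of tiles closed under passing to higher tiles
above it and next to it, borders the upper path, which has a north step just before the tile and
an east step just after it. -/
theorem exists_flippable_tile (ha : 0 < a) (hb : 0 < b) (hS : ∀ w ∈ S, IsBallot a b w)
    (hT : IsDyckTiling S lam ρ D) (hC : IsCoverInclusive lam D)
    (htile : ∀ d ∈ D, IsTileOn S d (s d) (t d) (g d)) {D' : Finset (Finset (ℤ × ℤ))}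
    (hD' : D' ⊆ D) (hne : D'.Nonempty)
    (habove : ∀ d ∈ D', ∀ e ∈ D, s d ≤ s e → t e ≤ t d → e ∈ D')
    (hnext : ∀ d ∈ D', (∀ i, s d ≤ i → i ≤ t d → g d i = eastCount ρ i) →
      ∀ c ∈ D, t c = s d - 1 ∨ s c = t d + 1 →
        baseLevel a b s g d < baseLevel a b s g c → c ∈ D') :
    ∃ d ∈ D', (∀ i, s d ≤ i → i ≤ t d → g d i = eastCount ρ i) ∧
      ∃ f : Fin (m + k) × Fin (m + k), f.1 < f.2 ∧ (f.1 : ℤ) + 1 = s d ∧ (f.2 : ℤ) = t d ∧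
        ρ.1 f.1 = DyckStep.U ∧ ρ.1 f.2 = DyckStep.D := by
  obtain ⟨d, hd, hmax⟩ := exists_max_image D' (baseLevel a b s g) hne
  have hdD := hD' hd
  have hle := (htile d hdD).le
  have htop : ∀ i, s d ≤ i → i ≤ t d → g d i = eastCount ρ i := by
    intro i h1 h2
    by_contra h3
    obtain ⟨e, he, -, -, h4, h5⟩ := exists_tile_above hT hC htile hdD h1 h2 h3
    have := hmax e (habove d hd e he h4.1 h4.2)
    have := baseLevel_lt_of_above ha hS htile hdD he h4 h5
    omega
  refine ⟨d, hd, htop, ?_⟩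
  have hreg : ∀ i, s d ≤ i → i ≤ t d → 0 < i ∧ i < m + k := by
    intro i h1 h2
    have h3 := hT.mem_region hdD ((htile d hdD).mem h1 h2)
    constructor <;> by_contra h4
    · rw [eastCount_of_nonpos _ (by omega), eastCount_of_nonpos _ (by omega)] at h3
      omega
    · rw [eastCount_of_ge _ (by omega), eastCount_of_ge _ (by omega)] at h3
      omega
  have hs := hreg _ le_rfl hle
  have ht := hreg _ hle le_rfl
  refine ⟨(⟨(s d - 1).toNat, by omega⟩, ⟨(t d).toNat, by omega⟩), ?_, ?_, ?_, ?_, ?_⟩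
  · rw [Fin.lt_def]
    simp only
    omega
  · simp only
    omega
  · simp only
    omega
  · apply DyckStep.eq_U_of_ne_D
    intro hD
    have h2 := eastCount_succ_of_D ρ hD
    simp only [show (((s d - 1).toNat : ℕ) : ℤ) = s d - 1 by omega, sub_add_cancel] at h2
    obtain ⟨c, hc, h3, h4⟩ := exists_tile_ending hS hT htile hdD (htop _ le_rfl hle) h2
    have := hmax c (hnext d hd htop c hc (Or.inl h3) (by omega))
    omega
  · by_contra hD
    have h2 := eastCount_succ_of_U ρ (DyckStep.eq_U_of_ne_D hD)
    simp only [show (((t d).toNat : ℕ) : ℤ) = t d by omega] at h2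
    obtain ⟨c, hc, h3, h4⟩ := exists_tile_starting hS hT htile hdD (htop _ hle le_rfl) h2
    have := hmax c (hnext d hd htop c hc (Or.inr h3) (by omega))
    omega

/-- If no tile lies strictly within a stretch `[p, q]` of the upper path that satisfies the ballot
condition, then one tile borders the whole stretch as soon as some tile borders a part of it. -/
theorem exists_tile_bordering (ha : 0 < a) (hb : 0 < b) (hS : ∀ w ∈ S, IsBallot a b w)
    (hT : IsDyckTiling S lam ρ D) (hC : IsCoverInclusive lam D)
    (htile : ∀ d ∈ D, IsTileOn S d (s d) (t d) (g d)) {p q : ℤ}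
    (hlev : ∀ l, p ≤ l → l ≤ q → level a b p (eastCount ρ p) ≤ level a b l (eastCount ρ l))
    (hlev' : level a b q (eastCount ρ q) = level a b p (eastCount ρ p))
    (hno : ∀ d ∈ D, ¬ (p < s d ∧ t d < q)) {i : ℤ} (hpi : p ≤ i) (hiq : i ≤ q)
    (hi : eastCount ρ i < eastCount lam i) :
    ∃ d ∈ D, ∀ l, p ≤ l → l ≤ q → boxAt l (eastCount ρ l) ∈ d := by
  have hbase : ∀ c ∈ D, s c ≤ q → p ≤ t c →
      baseLevel a b s g c ≤ level a b p (eastCount ρ p) := by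
    intro c hc h1 h2
    have h3 : ∀ l, s c ≤ l → l ≤ t c →
        baseLevel a b s g c ≤ level a b l (eastCount ρ l) := by
      intro l hl1 hl2
      refine ((htile c hc).level_le hS hl1 hl2).trans ((level_le_level ha).2 ?_)
      exact (hT.mem_region hc ((htile c hc).mem hl1 hl2)).1
    by_cases h4 : s c ≤ p
    · exact h3 p h4 h2
    · rw [← hlev']
      exact h3 q h1 (not_lt.1 fun h5 => hno c hc ⟨by omega, h5⟩)
  have hstart : ∀ d ∈ D, ¬ (p < s d ∧ s d ≤ q) := by
    intro d₀ hd₀ h₀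
    obtain ⟨d, hd, hmax⟩ := exists_max_image (D.filter fun d => p < s d ∧ s d ≤ q)
      (baseLevel a b s g) ⟨d₀, mem_filter.2 ⟨hd₀, h₀⟩⟩
    obtain ⟨hdD, h1, h2⟩ := mem_filter.1 hd
    have hle := (htile d hdD).le
    have htop : g d (s d) = eastCount ρ (s d) := by
      by_contra h3
      obtain ⟨e, he, -, h6, h4, h5⟩ := exists_tile_above hT hC htile hdD le_rfl hle h3
      have := hmax e (mem_filter.2 ⟨he, by omega, by omega⟩)
      have := baseLevel_lt_of_above ha hS htile hdD he h4 h5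
      omega
    have h3 := hbase d hdD h2 (by omega)
    have h4 := hlev (s d) h1.le h2
    rw [baseLevel, htop] at h3
    rcases eastCount_step ρ (s d - 1) with h5 | ⟨h5, -⟩
    · have h6 := level_succ (a := a) (b := b) (s d - 1) (eastCount ρ (s d - 1))
      have h7 := hlev (s d - 1) (by omega) (by omega)
      rw [← h5, sub_add_cancel] at h6
      rw [sub_add_cancel] at h5
      rw [← h5] at h7
      omega
    · rw [sub_add_cancel] at h5
      obtain ⟨c, hc, h6, h7⟩ := exists_tile_ending hS hT htile hdD htop h5
      have h8 := hbase c hc (by have := (htile c hc).le; omega) (by omega)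
      rw [h7, baseLevel, htop] at h8
      omega
  have hend : ∀ d ∈ D, ¬ (p ≤ t d ∧ t d < q) := by
    intro d₀ hd₀ h₀
    obtain ⟨d, hd, hmax⟩ := exists_max_image (D.filter fun d => p ≤ t d ∧ t d < q)
      (baseLevel a b s g) ⟨d₀, mem_filter.2 ⟨hd₀, h₀⟩⟩
    obtain ⟨hdD, h1, h2⟩ := mem_filter.1 hd
    have hle := (htile d hdD).le
    have htop : g d (t d) = eastCount ρ (t d) := by
      by_contra h3
      obtain ⟨e, he, -, h6, h4, h5⟩ := exists_tile_above hT hC htile hdD hle le_rfl h3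
      have := hmax e (mem_filter.2 ⟨he, by omega, by omega⟩)
      have := baseLevel_lt_of_above ha hS htile hdD he h4 h5
      omega
    have h3 := hbase d hdD (by omega) h1
    have h4 := hlev (t d) h1 h2.le
    have h9 := (htile d hdD).level_eq hS
    rw [baseLevel, ← h9, htop] at h3
    rcases eastCount_step ρ (t d) with h5 | ⟨h5, -⟩
    · obtain ⟨c, hc, h6, h7⟩ := exists_tile_starting hS hT htile hdD htop h5
      have h8 := hbase c hc (by omega) (by have := (htile c hc).le; omega)
      rw [h7, baseLevel, ← h9, htop] at h8
      omega
    · have h6 := level_succ_succ (a := a) (b := b) (t d) (eastCount ρ (t d))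
      have h7 := hlev (t d + 1) (by omega) (by omega)
      rw [← h5] at h6
      omega
  have hspan : ∀ d ∈ D, ∀ l, p ≤ l → l ≤ q → s d ≤ l → l ≤ t d → s d ≤ p ∧ q ≤ t d := by
    intro d hd l h1 h2 h3 h4
    have h5 := hstart d hd
    have h6 := hend d hd
    omega
  obtain ⟨d, hd, hdi⟩ := hT.exists_mem le_rfl hi
  obtain ⟨h1, h2⟩ := ((htile d hd).mem_iff _ _).1 hdi
  have h3 := hspan d hd i hpi hiq h1.1 h1.2
  refine ⟨d, hd, fun l hl1 hl2 => ?_⟩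
  rw [(htile d hd).mem_iff]
  refine ⟨⟨by omega, by omega⟩, ?_⟩
  by_contra h4
  -- a tile above `d` would span `[p, q]` too, and would stick out above the path at `i`
  obtain ⟨e, he, -, h5, -, h6⟩ := exists_tile_above hT hC htile hd (i := l) (by omega) (by omega)
    (Ne.symm h4)
  have h7 := hspan e he l hl1 hl2 h5.1 h5.2
  have h8 := hT.mem_region he ((htile e he).mem (i := i) (by omega) (by omega))
  have h9 := h6 i (by omega) (by omega)
  omega

end Tiling

/-! ### The sign-reversing involution -/

section Involution

variable {m k a b : ℕ} {S : Set (List DyckStep)} {lam π ρ : LatticePath m k}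
  {F : Finset (Fin (m + k) × Fin (m + k))} {D : Finset (Finset (ℤ × ℤ))}
  {f g : Fin (m + k) × Fin (m + k)}

/-- The index set of the expanded product of the two matrices: a set `F` of admissible pairs of
`π`, the path `ρ` that its flips lead to, and a cover-inclusive tiling `D` of `lam / ρ`. -/
structure IsConfig (S : Set (List DyckStep)) (lam π ρ : LatticePath m k)
    (F : Finset (Fin (m + k) × Fin (m + k))) (D : Finset (Finset (ℤ × ℤ))) : Prop where
  subset : F ⊆ admissiblePairs S π
  flip : flipPairs π F = ρ.1
  tiling : IsDyckTiling S lam ρ D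
  cover : IsCoverInclusive lam D

/-- The pair `f` can be moved: either `f` was flipped, and its tile may be given back to the tiling
without violating cover-inclusiveness, or its tile belongs to the tiling, and the pair may be
flipped instead. In both cases no flip strictly inside `f` has been made. -/
structure IsTogglable (S : Set (List DyckStep)) (lam π ρ : LatticePath m k)
    (F : Finset (Fin (m + k) × Fin (m + k))) (D : Finset (Finset (ℤ × ℤ)))
    (f : Fin (m + k) × Fin (m + k)) : Prop where
  mem : f ∈ admissiblePairs S π
  agree : ∀ l, f.1 < l → l < f.2 → ρ.1 l = π.1 l
  movable : (f ∈ F ∧ ((∃ d ∈ D, shiftSE (flipTile ρ f) ⊆ d) ∨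
      ∀ c ∈ shiftSE (flipTile ρ f), c ∉ young lam)) ∨
    (f ∉ F ∧ flipTile ρ f ∈ D)

theorem symmDiff_singleton_of_mem {β : Type*} [DecidableEq β] {s : Finset β} {x : β} (h : x ∈ s) :
    symmDiff s {x} = s.erase x := by
  ext y
  simp only [mem_symmDiff, mem_singleton, mem_erase]
  by_cases hy : y = x
  · subst hy; simp [h]
  · simp [hy]

theorem symmDiff_singleton_of_notMem {β : Type*} [DecidableEq β] {s : Finset β} {x : β}
    (h : x ∉ s) : symmDiff s {x} = insert x s := by
  ext y
  simp only [mem_symmDiff, mem_singleton, mem_insert]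
  by_cases hy : y = x
  · subst hy; simp [h]
  · simp [hy]

/-- The upper path of `flipTile ρ f` runs through the word between the positions of `f`. -/
theorem exists_flipTile_eq (hf : f.1 < f.2)
    (hρ : (ρ.1 f.1 = DyckStep.U ∧ ρ.1 f.2 = DyckStep.D) ∨
      (ρ.1 f.1 = DyckStep.D ∧ ρ.1 f.2 = DyckStep.U))
    (hagree : ∀ l, f.1 < l → l < f.2 → ρ.1 l = π.1 l) :
    ∃ c, flipTile ρ f = pathBoxes c (between π f.1 f.2) := by
  rcases hρ with ⟨h1, h2⟩ | ⟨h1, h2⟩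
  · exact ⟨_, by rw [flipTile_eq_pathBoxes hf h1 h2, between_congr hagree]⟩
  · have h := flipTile_eq_pathBoxes (ρ := swapPath ρ f) hf (by rw [swapPath_fst, h2])
      (by rw [swapPath_snd, h1])
    rw [flipTile_swapPath, between_congr (π := π) fun l h3 h4 => by
      rw [swapPath_of_ne ρ h3.ne' h4.ne, hagree l h3 h4]] at h
    exact ⟨_, h⟩

namespace IsConfig

theorem letters (ha : 0 < a) (hb : 0 < b) (hS : ∀ w ∈ S, IsBallot a b w)
    (hc : IsConfig S lam π ρ F D) (hf : f ∈ admissiblePairs S π) :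
    (f ∉ F ∧ ρ.1 f.1 = DyckStep.U ∧ ρ.1 f.2 = DyckStep.D) ∨
      (f ∈ F ∧ ρ.1 f.1 = DyckStep.D ∧ ρ.1 f.2 = DyckStep.U) := by
  by_cases hfF : f ∈ F
  · exact Or.inr ⟨hfF, flip_apply_fst hc.flip hfF, flip_apply_snd hc.subset hc.flip hfF⟩
  · exact Or.inl ⟨hfF, flip_apply_of_notMem ha hb hS hc.subset hc.flip hf hfF⟩

theorem toggle_flip (ha : 0 < a) (hb : 0 < b) (hS : ∀ w ∈ S, IsBallot a b w)
    (hc : IsConfig S lam π ρ F D) (hf : f ∈ admissiblePairs S π) :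
    flipPairs π (symmDiff F {f}) = (swapPath ρ f).1 := by
  have hf' := mem_admissiblePairs.1 hf
  funext x
  by_cases h1 : x = f.1
  · subst h1
    rw [swapPath_fst]
    rcases hc.letters ha hb hS hf with ⟨hfF, -, h2⟩ | ⟨hfF, -, h2⟩
    · rw [symmDiff_singleton_of_notMem hfF, h2, flipPairs,
        if_pos ⟨f, mem_insert_self _ _, rfl⟩]
    · rw [symmDiff_singleton_of_mem hfF, h2, flipPairs, if_neg, if_neg, hf'.2.1]
      · rintro ⟨e, he, h⟩
        have h3 := (mem_admissiblePairs.1 (hc.subset (mem_of_mem_erase he))).2.2.1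
        rw [h, hf'.2.1] at h3
        cases h3
      · rintro ⟨e, he, h⟩
        exact (mem_erase.1 he).1
          (admissible_eq_of_left_eq ha hS (hc.subset (mem_of_mem_erase he)) hf h)
  · by_cases h2 : x = f.2
    · subst h2
      rw [swapPath_snd]
      have h4 : ∀ e ∈ symmDiff F {f}, e.1 ≠ f.2 := by
        intro e he h
        have h5 : e ∈ admissiblePairs S π := by
          rcases mem_symmDiff.1 he with ⟨h, -⟩ | ⟨h, -⟩
          · exact hc.subset h
          · rwa [mem_singleton.1 h]
        have h3 := (mem_admissiblePairs.1 h5).2.1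
        rw [h, hf'.2.2.1] at h3
        cases h3
      rw [flipPairs, if_neg (by rintro ⟨e, he, h⟩; exact h4 e he h)]
      rcases hc.letters ha hb hS hf with ⟨hfF, h2, -⟩ | ⟨hfF, h2, -⟩
      · rw [symmDiff_singleton_of_notMem hfF, h2, if_pos ⟨f, mem_insert_self _ _, rfl⟩]
      · rw [symmDiff_singleton_of_mem hfF, h2, if_neg, hf'.2.2.1]
        rintro ⟨e, he, h⟩
        exact (mem_erase.1 he).1
          (admissible_eq_of_right_eq ha hb hS (hc.subset (mem_of_mem_erase he)) hf h)
    · rw [swapPath_of_ne ρ h1 h2, ← hc.flip]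
      -- the pair `f` does not affect the letter at `x`
      have h3 : ∀ P : Fin (m + k) × Fin (m + k) → Prop, ¬ P f →
          ((∃ e ∈ symmDiff F {f}, P e) ↔ ∃ e ∈ F, P e) := by
        intro P hP
        refine exists_congr fun e => and_congr_left fun he => ?_
        have : e ≠ f := fun h => hP (h ▸ he)
        simp [mem_symmDiff, this]
      simp only [flipPairs, h3 (fun e => e.1 = x) (Ne.symm h1), h3 (fun e => e.2 = x) (Ne.symm h2)]

theorem flipTile_notMem (ha : 0 < a) (hb : 0 < b) (hS : ∀ w ∈ S, IsBallot a b w)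
    (hc : IsConfig S lam π ρ F D) (hf : f ∈ admissiblePairs S π) (hfF : f ∈ F) :
    flipTile ρ f ∉ D := by
  intro h
  have hf' := (mem_admissiblePairs.1 hf).1
  have h1 := Fin.lt_def.1 hf'
  obtain ⟨h2, -⟩ | ⟨-, h2, h3⟩ := hc.letters ha hb hS hf
  · exact h2 hfF
  · have := hc.tiling.mem_region h
      ((boxAt_mem_flipTile' hf' h2 h3 (l := f.2)).2 ⟨⟨by omega, le_rfl⟩, rfl⟩)
    omega

theorem toggle (ha : 0 < a) (hb : 0 < b) (hS : ∀ w ∈ S, IsBallot a b w)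
    (hc : IsConfig S lam π ρ F D) (hf : IsTogglable S lam π ρ F D f) :
    IsConfig S lam π (swapPath ρ f) (symmDiff F {f}) (symmDiff D {flipTile ρ f}) := by
  have hf' := mem_admissiblePairs.1 hf.mem
  have hlt := Fin.lt_def.1 hf'.1
  have hT := hc.tiling
  have hsub : symmDiff F {f} ⊆ admissiblePairs S π := by
    intro e he
    rcases mem_symmDiff.1 he with ⟨h, -⟩ | ⟨h, -⟩
    · exact hc.subset h
    · rw [mem_singleton.1 h]; exact hf.mem
  have hflip := hc.toggle_flip ha hb hS hf.mem
  rcases hf.movable with ⟨hfF, hgood⟩ | ⟨hfF, hD⟩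
  · have hτ := hc.flipTile_notMem ha hb hS hf.mem hfF
    obtain ⟨h2, -⟩ | ⟨-, h2, h3⟩ := hc.letters ha hb hS hf.mem
    · exact absurd hfF h2
    have hE := eastCount_swapPath (swapPath ρ f) hf'.1 (by rw [swapPath_fst, h3])
      (by rw [swapPath_snd, h2])
    rw [swapPath_swapPath] at hE
    have hsub' := (young_subset_iff lam ρ).1 hT.1
    have hunion : ∀ l x, boxAt l x ∈ young lam \ young (swapPath ρ f) ↔
        boxAt l x ∈ flipTile ρ f ∨ boxAt l x ∈ young lam \ young ρ := by
      intro l x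
      have h4 := hE l
      have h5 := hsub' l
      rw [boxAt_mem_young_sdiff, boxAt_mem_young_sdiff, boxAt_mem_flipTile' hf'.1 h2 h3]
      split_ifs at h4 <;> omega
    have hdisj : ∀ d ∈ D, Disjoint (flipTile ρ f) d := by
      intro d hd
      rw [disjoint_left]
      intro c hc1 hc2
      obtain ⟨l, x, rfl⟩ := exists_eq_boxAt c
      have h4 := hT.mem_region hd hc2
      rw [boxAt_mem_flipTile' hf'.1 h2 h3] at hc1
      omega
    rw [symmDiff_singleton_of_notMem hτ]
    refine ⟨hsub, hflip, ⟨?_, ?_, ?_, ?_⟩, ?_⟩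
    · rw [young_subset_iff]
      intro l
      have h4 := hE l
      have h5 := hsub' l
      split_ifs at h4 <;> omega
    · intro d hd
      rcases mem_insert.1 hd with rfl | hd
      · obtain ⟨c, h⟩ := exists_flipTile_eq hf'.1 (Or.inr ⟨h2, h3⟩) hf.agree
        exact ⟨_, hf'.2.2.2, c, h⟩
      · exact hT.2.1 d hd
    · intro d₁ hd₁ d₂ hd₂ hne
      rcases mem_insert.1 hd₁ with rfl | hd₁ <;> rcases mem_insert.1 hd₂ with rfl | hd₂
      · exact absurd rfl hne
      · exact hdisj d₂ hd₂
      · exact (hdisj d₁ hd₁).symm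
      · exact hT.2.2.1 d₁ hd₁ d₂ hd₂ hne
    · rw [biUnion_insert, hT.2.2.2]
      refine finset_ext_boxAt fun l x => ?_
      rw [hunion, mem_union, id]
    · intro d hd
      rcases mem_insert.1 hd with rfl | hd
      · refine hgood.imp_left ?_
        rintro ⟨e, he, h⟩
        exact ⟨e, mem_insert_of_mem he, fun h => hτ (h ▸ he), h⟩
      · refine (hc.cover d hd).imp_left ?_
        rintro ⟨e, he, h⟩
        exact ⟨e, mem_insert_of_mem he, h⟩
  · obtain ⟨-, h2, h3⟩ | ⟨h2, -⟩ := hc.letters ha hb hS hf.mem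
    swap
    · exact absurd h2 hfF
    have hE := eastCount_swapPath ρ hf'.1 h2 h3
    have hmem := fun l x => boxAt_mem_flipTile (l := l) (x := x) hf'.1 h2 h3
    rw [symmDiff_singleton_of_mem hD]
    refine ⟨hsub, hflip, ⟨?_, ?_, ?_, ?_⟩, ?_⟩
    · rw [young_subset_iff]
      intro l
      have h4 := hE l
      have h5 := (young_subset_iff lam ρ).1 hT.1 l
      split_ifs at h4 with h6
      · have := hT.mem_region hD ((hmem l _).2 ⟨⟨by omega, h6.2⟩, rfl⟩)
        omega
      · omega
    · exact fun d hd => hT.2.1 d (mem_of_mem_erase hd)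
    · exact fun d₁ hd₁ d₂ hd₂ => hT.2.2.1 d₁ (mem_of_mem_erase hd₁) d₂ (mem_of_mem_erase hd₂)
    · refine finset_ext_boxAt fun l x => ?_
      have h4 : boxAt l x ∈ (D.erase (flipTile ρ f)).biUnion id ↔
          boxAt l x ∈ D.biUnion id ∧ boxAt l x ∉ flipTile ρ f := by
        simp only [mem_biUnion, mem_erase, id]
        constructor
        · rintro ⟨d, ⟨hne, hd⟩, h⟩
          exact ⟨⟨d, hd, h⟩, fun h' => hne (hT.eq_of_mem hd hD h h')⟩
        · rintro ⟨⟨d, hd, h⟩, h'⟩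
          exact ⟨d, ⟨fun he => h' (he ▸ h), hd⟩, h⟩
      have h5 := hE l
      rw [h4, hT.2.2.2, boxAt_mem_young_sdiff, boxAt_mem_young_sdiff, hmem]
      split_ifs at h5 <;> omega
    · intro d hd
      obtain ⟨hne, hd⟩ := mem_erase.1 hd
      refine (hc.cover d hd).imp_left ?_
      rintro ⟨e, he, hed, h⟩
      refine ⟨e, mem_erase.2 ⟨?_, he⟩, hed, h⟩
      -- nothing in the region lies over a tile that borders the upper path
      rintro rfl
      obtain ⟨s, t, g, hd'⟩ := (hT.2.1 d hd).exists_isTileOn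
      have h4 := hd'.mem le_rfl hd'.le
      have h5 := h (boxAt_mem_shiftSE.2 (by rwa [add_sub_cancel_right]))
      rw [hmem] at h5
      have := hT.mem_region hd h4
      omega

/-- Two pairs that can be moved are never nested: the tiling would have to contain the inner tile,
and to cover the larger outer tile or its translate by a single tile. -/
theorem not_nested (ha : 0 < a) (hb : 0 < b) (hS : ∀ w ∈ S, IsBallot a b w)
    (hc : IsConfig S lam π ρ F D) (hf : IsTogglable S lam π ρ F D f)
    (hg : IsTogglable S lam π ρ F D g) (h1 : g.1 < f.1) (h2 : f.2 < g.2) : False := by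
  have hf' := mem_admissiblePairs.1 hf.mem
  have hg' := mem_admissiblePairs.1 hg.mem
  have hU : ρ.1 f.1 = DyckStep.U := by rw [hg.agree _ h1 (hf'.1.trans h2), hf'.2.1]
  have hD : ρ.1 f.2 = DyckStep.D := by rw [hg.agree _ (h1.trans hf'.1) h2, hf'.2.2.1]
  have hfD : flipTile ρ f ∈ D := by
    rcases hf.movable with ⟨h, -⟩ | ⟨-, h⟩
    · rw [flip_apply_fst hc.flip h] at hU
      cases hU
    · exact h
  have hmem := fun l x => boxAt_mem_flipTile (l := l) (x := x) hf'.1 hU hD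
  rw [Fin.lt_def] at h1 h2
  have h3 := Fin.lt_def.1 hf'.1
  have h4 := Fin.lt_def.1 hg'.1
  -- a tile that contains the upper boundary of the region along `g` cannot be the tile of `f`
  have key : ∀ d ∈ D, (∀ l : ℤ, g.1 + 1 ≤ l → l ≤ g.2 → boxAt l (eastCount ρ l) ∈ d) → False := by
    intro d hd h
    have h5 := hc.tiling.eq_of_mem hfD hd ((hmem f.2 _).2 ⟨⟨by omega, le_rfl⟩, rfl⟩)
      (h f.2 (by omega) (by omega))
    subst h5
    have h6 := (hmem _ _).1 (h g.2 (by omega) le_rfl)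
    omega
  obtain ⟨h5, h6, h7⟩ | ⟨h5, h6, h7⟩ := hc.letters ha hb hS hg.mem
  · rcases hg.movable with ⟨h, -⟩ | ⟨-, h⟩
    · exact h5 h
    · exact key _ h fun l hl1 hl2 => (boxAt_mem_flipTile hg'.1 h6 h7).2 ⟨⟨hl1, hl2⟩, rfl⟩
  · have h8 : ∀ l : ℤ, g.1 + 1 ≤ l → l ≤ g.2 →
        boxAt l (eastCount ρ l) ∈ shiftSE (flipTile ρ g) := fun l hl1 hl2 =>
      boxAt_mem_shiftSE.2 ((boxAt_mem_flipTile' hg'.1 h6 h7).2 ⟨⟨hl1, hl2⟩, rfl⟩)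
    rcases hg.movable with ⟨-, ⟨d, hd, h⟩ | h⟩ | ⟨h, -⟩
    · exact key d hd fun l hl1 hl2 => h (h8 l hl1 hl2)
    · refine h _ (h8 f.2 (by omega) (by omega)) ?_
      rw [boxAt_mem_young_of_le lam ρ le_rfl]
      exact (hc.tiling.mem_region hfD ((hmem f.2 _).2 ⟨⟨by omega, le_rfl⟩, rfl⟩)).2
    · exact h h5

/-- Moving a pair does not change the set of pairs that can be moved. -/
theorem isTogglable_toggle (ha : 0 < a) (hb : 0 < b) (hS : ∀ w ∈ S, IsBallot a b w)
    (hc : IsConfig S lam π ρ F D) (hf : IsTogglable S lam π ρ F D f)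
    (hg : IsTogglable S lam π ρ F D g) :
    IsTogglable S lam π (swapPath ρ f) (symmDiff F {f}) (symmDiff D {flipTile ρ f}) g := by
  have hf' := mem_admissiblePairs.1 hf.mem
  have hg' := mem_admissiblePairs.1 hg.mem
  have hflt := Fin.lt_def.1 hf'.1
  have hglt := Fin.lt_def.1 hg'.1
  by_cases hfg : f = g
  · subst hfg
    refine ⟨hf.mem, fun l h1 h2 => ?_, ?_⟩
    · rw [swapPath_of_ne ρ h1.ne' h2.ne, hf.agree l h1 h2]
    · rw [flipTile_swapPath]
      rcases hf.movable with ⟨hfF, -⟩ | ⟨hfF, hD⟩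
      · refine Or.inr ⟨by simp [symmDiff_singleton_of_mem hfF], ?_⟩
        rw [symmDiff_singleton_of_notMem (hc.flipTile_notMem ha hb hS hf.mem hfF)]
        exact mem_insert_self _ _
      · refine Or.inl ⟨by simp [symmDiff_singleton_of_notMem hfF], ?_⟩
        refine (hc.cover _ hD).imp_left ?_
        rintro ⟨d, hd, hne, h⟩
        rw [symmDiff_singleton_of_mem hD]
        exact ⟨d, mem_erase.2 ⟨hne, hd⟩, h⟩
  have hdisj : f.2 < g.1 ∨ g.2 < f.1 := by
    rcases admissible_trichotomy ha hb hS hf.mem hg.mem hfg with h | h | h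
    · exact h
    · exact (hc.not_nested ha hb hS hg hf h.1 h.2).elim
    · exact (hc.not_nested ha hb hS hf hg h.1 h.2).elim
  rw [Fin.lt_def, Fin.lt_def] at hdisj
  have hfix : ∀ l : Fin (m + k), g.1 ≤ l → l ≤ g.2 → (swapPath ρ f).1 l = ρ.1 l := by
    intro l h1 h2
    rw [Fin.le_def] at h1 h2
    exact swapPath_of_ne ρ (by rw [Ne, Fin.ext_iff]; omega) (by rw [Ne, Fin.ext_iff]; omega)
  have hcount : ∀ l : ℤ, g.1 + 1 ≤ l → l ≤ g.2 →
      eastCount (swapPath ρ f) l = eastCount ρ l := by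
    intro l h1 h2
    obtain ⟨-, h3, h4⟩ | ⟨-, h3, h4⟩ := hc.letters ha hb hS hf.mem
    · rw [eastCount_swapPath ρ hf'.1 h3 h4, if_neg] <;> omega
    · have h5 := eastCount_swapPath (swapPath ρ f) hf'.1 (by rw [swapPath_fst, h4])
        (by rw [swapPath_snd, h3]) l
      rw [swapPath_swapPath, if_neg (by omega)] at h5
      omega
  have hle := hg'.1.le
  have htile : flipTile (swapPath ρ f) g = flipTile ρ g := by
    refine finset_ext_boxAt fun l x => ?_
    obtain ⟨-, h3, h4⟩ | ⟨-, h3, h4⟩ := hc.letters ha hb hS hg.mem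
    · rw [boxAt_mem_flipTile hg'.1 h3 h4, boxAt_mem_flipTile hg'.1 (by rwa [hfix _ le_rfl hle])
        (by rwa [hfix _ hle le_rfl])]
      exact and_congr_right fun h => by rw [hcount l h.1 h.2]
    · rw [boxAt_mem_flipTile' hg'.1 h3 h4, boxAt_mem_flipTile' hg'.1
        (by rwa [hfix _ le_rfl hle]) (by rwa [hfix _ hle le_rfl])]
      exact and_congr_right fun h => by rw [hcount l h.1 h.2]
  have hmemF : g ∈ symmDiff F {f} ↔ g ∈ F := by
    simp [mem_symmDiff, Ne.symm hfg]
  -- the tile of `f` occupies other antidiagonals than the tile of `g`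
  have hmemD : ∀ d ∈ D, (∃ x, boxAt (g.1 + 1) x ∈ d) → d ∈ symmDiff D {flipTile ρ f} := by
    rintro d hd ⟨x, hx⟩
    refine mem_symmDiff.2 (Or.inl ⟨hd, fun h => ?_⟩)
    rw [mem_singleton.1 h] at hx
    obtain ⟨-, h3, h4⟩ | ⟨-, h3, h4⟩ := hc.letters ha hb hS hf.mem
    · rw [boxAt_mem_flipTile hf'.1 h3 h4] at hx
      omega
    · rw [boxAt_mem_flipTile' hf'.1 h3 h4] at hx
      omega
  have hbox : ∃ x, boxAt (g.1 + 1) x ∈ flipTile ρ g := by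
    obtain ⟨-, h3, h4⟩ | ⟨-, h3, h4⟩ := hc.letters ha hb hS hg.mem
    · exact ⟨_, (boxAt_mem_flipTile hg'.1 h3 h4).2 ⟨⟨le_rfl, by omega⟩, rfl⟩⟩
    · exact ⟨_, (boxAt_mem_flipTile' hg'.1 h3 h4).2 ⟨⟨le_rfl, by omega⟩, rfl⟩⟩
  refine ⟨hg.mem, fun l h1 h2 => by rw [hfix l h1.le h2.le, hg.agree l h1 h2], ?_⟩
  rw [htile, hmemF]
  refine hg.movable.imp (And.imp_right (Or.imp_left ?_)) (And.imp_right fun h => hmemD _ h hbox)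
  rintro ⟨d, hd, h⟩
  obtain ⟨x, hx⟩ := hbox
  exact ⟨d, hmemD d hd ⟨x + 1, h (boxAt_mem_shiftSE.2 (by rwa [add_sub_cancel_right]))⟩, h⟩

end IsConfig

/-- A word is determined by the numbers of east steps in its prefixes. -/
theorem eq_of_count_take {v w : List DyckStep} (hl : v.length = w.length)
    (h : ∀ n ≤ v.length, (v.take n).count DyckStep.D = (w.take n).count DyckStep.D) : v = w := by
  apply List.ext_getElem hl
  intro n h1 h2
  have h3 := h (n + 1) h1
  rw [List.take_succ_eq_append_getElem h1, List.take_succ_eq_append_getElem h2,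
    List.count_append, List.count_append, h n h1.le] at h3
  cases h4 : v[n] <;> cases h5 : w[n] <;> simp_all

/-- A tile that borders the path `ρ` between the two positions of `f` is the tile of `f`. -/
theorem IsTileOn.eq_flipTile {d : Finset (ℤ × ℤ)} {s t : ℤ} {γ : ℤ → ℤ}
    (hd : IsTileOn S d s t γ) (htop : ∀ i, s ≤ i → i ≤ t → γ i = eastCount ρ i) (hf : f.1 < f.2)
    (hs : (f.1 : ℤ) + 1 = s) (ht : (f.2 : ℤ) = t) (hU : ρ.1 f.1 = DyckStep.U)
    (hD : ρ.1 f.2 = DyckStep.D) : flipTile ρ f = d ∧ between ρ f.1 f.2 ∈ S := by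
  subst hs ht
  constructor
  · refine finset_ext_boxAt fun l x => ?_
    rw [boxAt_mem_flipTile hf hU hD, hd.mem_iff]
    exact and_congr_right fun h => by rw [htop l h.1 h.2]
  · obtain ⟨w, hw, hl, h⟩ := hd.word
    have h1 := length_between ρ f.1 f.2
    have h2 := Fin.lt_def.1 hf
    rw [eq_of_count_take (v := between ρ f.1 f.2) (w := w) (by omega)]
    · exact hw
    · intro n hn
      have h3 := eastCount_between ρ f.1 f.2 n hn
      have h4 := h n (by omega)
      rw [htop _ (by omega) (by omega), htop _ le_rfl (by omega)] at h4
      omega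

/-- Some pair can be moved unless there is neither a flip nor a tile. -/
theorem IsConfig.exists_isTogglable (ha : 0 < a) (hb : 0 < b) (hS : ∀ w ∈ S, IsBallot a b w)
    (hc : IsConfig S lam π ρ F D) (hne : ¬ (F = ∅ ∧ D = ∅)) :
    ∃ f, IsTogglable S lam π ρ F D f := by
  have hT := hc.tiling
  have hex : ∀ d : Finset (ℤ × ℤ), ∃ s t γ, d ∈ D → IsTileOn S d s t γ := by
    intro d
    by_cases hd : d ∈ D
    · obtain ⟨s, t, γ, h⟩ := (hT.2.1 d hd).exists_isTileOn
      exact ⟨s, t, γ, fun _ => h⟩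
    · exact ⟨0, 0, 0, fun h => absurd h hd⟩
  choose s t γ htile using hex
  rcases F.eq_empty_or_nonempty with hF | hF
  · subst hF
    have hρ : ρ = π := Subtype.ext (funext fun x => flip_apply_of_ne hc.flip (by simp))
    subst hρ
    have hD : D.Nonempty := nonempty_iff_ne_empty.2 fun h => hne ⟨rfl, h⟩
    obtain ⟨d, hd, htop, f, hf, hs, ht, hfU, hfD⟩ := exists_flippable_tile ha hb hS hT hc.cover
      htile subset_rfl hD (fun _ _ e he _ _ => he) (fun _ _ _ c hc _ _ => hc)
    obtain ⟨h1, h2⟩ := (htile d hd).eq_flipTile htop hf hs ht hfU hfD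
    exact ⟨f, mem_admissiblePairs.2 ⟨hf, hfU, hfD, h2⟩, fun _ _ _ => rfl,
      Or.inr ⟨notMem_empty _, h1 ▸ hd⟩⟩
  -- an innermost flipped pair
  obtain ⟨f, hfF, hmin⟩ := exists_min_image F (fun f => (f.2 : ℤ) - f.1) hF
  have hfA := hc.subset hfF
  have hf' := mem_admissiblePairs.1 hfA
  have hlt := Fin.lt_def.1 hf'.1
  have hD := flip_apply_fst hc.flip hfF
  have hU := flip_apply_snd hc.subset hc.flip hfF
  have hagree : ∀ l, f.1 < l → l < f.2 → ρ.1 l = π.1 l := by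
    intro l h1 h2
    refine flip_apply_of_ne hc.flip fun e he => ?_
    by_contra h3
    rw [← not_or, not_not] at h3
    have hef : f ≠ e := by
      rintro rfl
      rcases h3 with rfl | rfl
      · exact lt_irrefl _ h1
      · exact lt_irrefl _ h2
    have h4 := admissible_trichotomy ha hb hS hfA (hc.subset he) hef
    have h5 := hmin e he
    have h6 := (mem_admissiblePairs.1 (hc.subset he)).1
    simp only [Fin.ext_iff, Fin.lt_def] at h1 h2 h3 h4 h6
    omega
  have hbet : between ρ f.1 f.2 ∈ S := by rw [between_congr hagree]; exact hf'.2.2.2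
  have hρtile := isTileOn_between ρ hf'.1 hbet
  have hlev := fun l (h1 : (f.1 : ℤ) + 1 ≤ l) (h2 : l ≤ f.2) => hρtile.level_le hS h1 h2
  have hlev' := hρtile.level_eq hS
  by_cases hno : ∀ d ∈ D, ¬ ((f.1 : ℤ) + 1 < s d ∧ t d < f.2)
  · refine ⟨f, hfA, hagree, Or.inl ⟨hfF, ?_⟩⟩
    have hshift : ∀ c ∈ shiftSE (flipTile ρ f),
        ∃ l : ℤ, (f.1 + 1 ≤ l ∧ l ≤ f.2) ∧ c = boxAt l (eastCount ρ l) := by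
      intro c hc
      obtain ⟨l, x, rfl⟩ := exists_eq_boxAt c
      rw [boxAt_mem_shiftSE, boxAt_mem_flipTile' hf'.1 hD hU] at hc
      exact ⟨l, hc.1, by rw [show x = eastCount ρ l by omega]⟩
    by_cases hi : ∃ i : ℤ, (f.1 + 1 ≤ i ∧ i ≤ f.2) ∧ eastCount ρ i < eastCount lam i
    · obtain ⟨i, ⟨h1, h2⟩, h3⟩ := hi
      obtain ⟨d, hd, h⟩ :=
        exists_tile_bordering ha hb hS hT hc.cover htile hlev hlev' hno h1 h2 h3
      refine Or.inl ⟨d, hd, fun c hc => ?_⟩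
      obtain ⟨l, ⟨h4, h5⟩, rfl⟩ := hshift c hc
      exact h l h4 h5
    · refine Or.inr fun c hc => ?_
      obtain ⟨l, hl, rfl⟩ := hshift c hc
      rw [boxAt_mem_young_of_le lam ρ le_rfl]
      exact fun h => hi ⟨l, hl, h⟩
  · push Not at hno
    obtain ⟨d₀, hd₀, h₀⟩ := hno
    obtain ⟨d, hd, htop, g, hg, hs, ht, hgU, hgD⟩ := exists_flippable_tile ha hb hS hT hc.cover
      htile (D' := D.filter fun d => (f.1 : ℤ) + 1 < s d ∧ t d < f.2) (filter_subset _ _)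
      ⟨d₀, mem_filter.2 ⟨hd₀, h₀⟩⟩
      (by
        intro d hd e he h1 h2
        have := (mem_filter.1 hd).2
        exact mem_filter.2 ⟨he, by omega, by omega⟩)
      (by
        -- a neighbour that sticks out of the range of `f` has a base level below that of `d`
        intro d hd htop c hcD hnext hbase
        obtain ⟨hdD, h1, h2⟩ := mem_filter.1 hd
        have hle := (htile d hdD).le
        have hle' := (htile c hcD).le
        have h3 := hlev (s d) h1.le (by omega)
        have h4 : ∀ l, s c ≤ l → l ≤ t c →
            baseLevel a b s γ c ≤ level a b l (eastCount ρ l) := by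
          intro l hl1 hl2
          refine ((htile c hcD).level_le hS hl1 hl2).trans ((level_le_level ha).2 ?_)
          exact (hT.mem_region hcD ((htile c hcD).mem hl1 hl2)).1
        rw [baseLevel, htop _ le_rfl hle] at hbase
        refine mem_filter.2 ⟨hcD, ?_, ?_⟩ <;> by_contra h5
        · have := h4 (f.1 + 1) (by omega) (by omega)
          omega
        · have := h4 f.2 (by omega) (by omega)
          omega)
    obtain ⟨hdD, h1, h2⟩ := mem_filter.1 hd
    obtain ⟨h3, h4⟩ := (htile d hdD).eq_flipTile htop hg hs ht hgU hgD
    have h5 : f.1 < g.1 := by rw [Fin.lt_def]; omega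
    have h6 : g.2 < f.2 := by rw [Fin.lt_def]; omega
    have hagree' : ∀ l, g.1 < l → l < g.2 → ρ.1 l = π.1 l := fun l h7 h8 =>
      hagree l (h5.trans h7) (h8.trans h6)
    refine ⟨g, mem_admissiblePairs.2 ⟨hg, ?_, ?_, ?_⟩, hagree', Or.inr ⟨fun h => ?_, h3 ▸ hdD⟩⟩
    · rw [← hagree _ h5 (hg.trans h6), hgU]
    · rw [← hagree _ (h5.trans hg) h6, hgD]
    · rwa [← between_congr hagree']
    · rw [flip_apply_fst hc.flip h] at hgU
      cases hgU

end Involution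

/-! ### Summation -/

section Summation

variable {m k a b : ℕ} {S : Set (List DyckStep)} {lam π ρ : LatticePath m k}
  {F : Finset (Fin (m + k) × Fin (m + k))} {D : Finset (Finset (ℤ × ℤ))}

theorem isConfig_iff : IsConfig S lam π ρ F D ↔
    F ∈ flipSets S ρ π ∧ D ∈ coverInclusiveTilings S lam ρ := by
  classical
  simp only [flipSets, coverInclusiveTilings, mem_filter, mem_powerset]
  constructor
  · intro h
    refine ⟨⟨h.subset, h.flip⟩, fun d hd => mem_powerset.2 ?_, h.tiling, h.cover⟩
    rw [← h.tiling.2.2.2]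
    exact subset_biUnion_of_mem id hd
  · rintro ⟨⟨h1, h2⟩, -, h3, h4⟩
    exact ⟨h1, h2, h3, h4⟩

/-- The signed weight of a configuration; `u` gives the exponent of a flip in terms of the word
between its positions, and `stat` the exponent of a tile. -/
noncomputable def configWeight (u : List DyckStep → ℕ) (stat : Finset (ℤ × ℤ) → ℕ)
    (π : LatticePath m k) (F : Finset (Fin (m + k) × Fin (m + k)))
    (D : Finset (Finset (ℤ × ℤ))) : Polynomial ℤ :=
  (∏ d ∈ D, Polynomial.X ^ stat d) * ∏ f ∈ F, -Polynomial.X ^ u (between π f.1 f.2)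

theorem IsConfig.configWeight_add_toggle (ha : 0 < a) (hb : 0 < b)
    (hS : ∀ w ∈ S, IsBallot a b w) {u : List DyckStep → ℕ} {stat : Finset (ℤ × ℤ) → ℕ}
    (hstat : ∀ w ∈ S, ∀ c, stat (pathBoxes c w) = u w) (hc : IsConfig S lam π ρ F D)
    {f : Fin (m + k) × Fin (m + k)} (hf : IsTogglable S lam π ρ F D f) :
    configWeight u stat π F D +
      configWeight u stat π (symmDiff F {f}) (symmDiff D {flipTile ρ f}) = 0 := by
  have hf' := mem_admissiblePairs.1 hf.mem
  have hu : stat (flipTile ρ f) = u (between π f.1 f.2) := by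
    obtain ⟨c, h⟩ := exists_flipTile_eq hf'.1
      ((hc.letters ha hb hS hf.mem).imp And.right And.right) hf.agree
    rw [h, hstat _ hf'.2.2.2]
  unfold configWeight
  rcases hf.movable with ⟨hfF, -⟩ | ⟨hfF, hD⟩
  · rw [symmDiff_singleton_of_mem hfF, symmDiff_singleton_of_notMem
      (hc.flipTile_notMem ha hb hS hf.mem hfF), ← mul_prod_erase F _ hfF,
      prod_insert (hc.flipTile_notMem ha hb hS hf.mem hfF), hu]
    ring
  · rw [symmDiff_singleton_of_notMem hfF, symmDiff_singleton_of_mem hD,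
      ← mul_prod_erase D _ hD, prod_insert hfF, hu]
    ring

/-- A configuration without flips and tiles exists only for equal paths. -/
theorem isConfig_empty_iff : IsConfig S lam π ρ ∅ ∅ ↔ ρ = π ∧ lam = π := by
  constructor
  · intro h
    have hρ : ρ = π := Subtype.ext (funext fun x => flip_apply_of_ne h.flip (by simp))
    subst hρ
    have h1 := (young_subset_iff lam ρ).1 h.tiling.1
    have h2 : young lam ⊆ young ρ := by
      rw [← sdiff_eq_empty_iff_subset, ← h.tiling.2.2.2, biUnion_empty]
    rw [young_subset_iff] at h2
    exact ⟨rfl, eastCount_injective fun i => le_antisymm (h2 i) (h1 i)⟩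
  · rintro ⟨rfl, rfl⟩
    refine ⟨empty_subset _, ?_, ⟨subset_rfl, by simp, by simp, by simp⟩, by simp [IsCoverInclusive]⟩
    funext x
    simp [flipPairs]

/-- The matrix of tilings is a left inverse of the matrix of flips. -/
theorem tilings_mul_flips (ha : 0 < a) (hb : 0 < b)
    (hS : ∀ w ∈ S, IsBallot a b w) {u : List DyckStep → ℕ} {stat : Finset (ℤ × ℤ) → ℕ}
    (hstat : ∀ w ∈ S, ∀ c, stat (pathBoxes c w) = u w) :
    (Matrix.of fun lam ρ : LatticePath m k => ∑ D ∈ coverInclusiveTilings S lam ρ,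
        ∏ d ∈ D, (Polynomial.X : Polynomial ℤ) ^ stat d) *
      (Matrix.of fun ρ π : LatticePath m k => ∑ F ∈ flipSets S ρ π,
        ∏ f ∈ F, -(Polynomial.X : Polynomial ℤ) ^ u (between π f.1 f.2)) = 1 := by
  classical
  ext1 lam π
  rw [Matrix.mul_apply, Matrix.one_apply]
  simp only [Matrix.of_apply]
  let C : Finset (Σ _ : LatticePath m k,
      Finset (Finset (ℤ × ℤ)) × Finset (Fin (m + k) × Fin (m + k))) :=
    univ.sigma fun ρ => coverInclusiveTilings S lam ρ ×ˢ flipSets S ρ π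
  have hC : ∀ x, x ∈ C ↔ IsConfig S lam π x.1 x.2.2 x.2.1 := by
    intro x
    rw [isConfig_iff]
    simp only [C, mem_sigma, mem_univ, mem_product, true_and]
    exact and_comm
  have hsum : ∀ ρ : LatticePath m k, (∑ D ∈ coverInclusiveTilings S lam ρ,
        ∏ d ∈ D, (Polynomial.X : Polynomial ℤ) ^ stat d) *
      (∑ F ∈ flipSets S ρ π, ∏ f ∈ F, -(Polynomial.X : Polynomial ℤ) ^ u (between π f.1 f.2)) =
      ∑ x ∈ coverInclusiveTilings S lam ρ ×ˢ flipSets S ρ π, configWeight u stat π x.2 x.1 := by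
    intro ρ
    rw [sum_mul_sum, sum_product]
    rfl
  rw [sum_congr rfl fun ρ _ => hsum ρ,
    ← sum_sigma univ (fun ρ => coverInclusiveTilings S lam ρ ×ˢ flipSets S ρ π)
      fun x => configWeight u stat π x.2.2 x.2.1,
    ← sum_filter_add_sum_filter_not _ fun x => x.2.2 = ∅ ∧ x.2.1 = ∅]
  -- the set of pairs that can be moved, which is invariant under moving one of them
  let A := fun x : (Σ _ : LatticePath m k,
      Finset (Finset (ℤ × ℤ)) × Finset (Fin (m + k) × Fin (m + k))) =>
    {f | IsTogglable S lam π x.1 x.2.2 x.2.1 f}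
  let move := fun (x : Σ _ : LatticePath m k,
      Finset (Finset (ℤ × ℤ)) × Finset (Fin (m + k) × Fin (m + k))) f =>
    (⟨swapPath x.1 f, symmDiff x.2.1 {flipTile x.1 f}, symmDiff x.2.2 {f}⟩ :
      Σ _ : LatticePath m k,
        Finset (Finset (ℤ × ℤ)) × Finset (Fin (m + k) × Fin (m + k)))
  have hmove : ∀ x f, move (move x f) f = x := by
    intro x f
    simp only [move, swapPath_swapPath, flipTile_swapPath, symmDiff_assoc, symmDiff_self,
      symmDiff_bot]
  have hmem : ∀ x ∈ C, ∀ f ∈ A x, move x f ∈ C := fun x hx f hf =>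
    (hC _).2 (((hC x).1 hx).toggle ha hb hS hf)
  have hsub : ∀ x ∈ C, ∀ f ∈ A x, A x ⊆ A (move x f) := fun x hx f hf g hg =>
    ((hC x).1 hx).isTogglable_toggle ha hb hS hf hg
  have hA : ∀ x ∈ C, ∀ f ∈ A x, A (move x f) = A x := by
    intro x hx f hf
    refine subset_antisymm ?_ (hsub x hx f hf)
    have := hsub _ (hmem x hx f hf) f (hsub x hx f hf hf)
    rwa [hmove] at this
  have hA0 : ∀ x, x.2.2 = ∅ ∧ x.2.1 = ∅ → ¬ (A x).Nonempty := by
    rintro x ⟨h1, h2⟩ ⟨f, hf⟩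
    rcases hf.movable with ⟨h, -⟩ | ⟨-, h⟩
    · rw [h1] at h; exact notMem_empty _ h
    · rw [h2] at h; exact notMem_empty _ h
  have hAne : ∀ x ∈ C.filter (fun x => ¬ (x.2.2 = ∅ ∧ x.2.1 = ∅)), (A x).Nonempty := by
    intro x hx
    obtain ⟨hx, hne⟩ := mem_filter.1 hx
    exact ((hC x).1 hx).exists_isTogglable ha hb hS hne
  have hsome : ∀ (B B' : Set (Fin (m + k) × Fin (m + k))) (h : B.Nonempty) (h' : B'.Nonempty),
      B = B' → h.some = h'.some := by
    rintro B _ h h' rfl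
    rfl
  have hzero : ∑ x ∈ C.filter (fun x => ¬ (x.2.2 = ∅ ∧ x.2.1 = ∅)),
      configWeight u stat π x.2.2 x.2.1 = 0 := by
    refine sum_involution (fun x hx => move x (hAne x hx).some) ?_ ?_ ?_ ?_
    · intro x hx
      exact ((hC x).1 (mem_filter.1 hx).1).configWeight_add_toggle ha hb hS hstat
        (hAne x hx).some_mem
    · intro x hx _ h
      have h1 : symmDiff x.2.2 {(hAne x hx).some} = x.2.2 := congrArg (fun x => x.2.2) h
      simp at h1
    · intro x hx
      have hxC := (mem_filter.1 hx).1
      refine mem_filter.2 ⟨hmem x hxC _ (hAne x hx).some_mem, fun h => hA0 _ h ?_⟩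
      rw [hA x hxC _ (hAne x hx).some_mem]
      exact hAne x hx
    · intro x hx
      have hxC := (mem_filter.1 hx).1
      rw [hsome _ _ _ (hAne x hx) (hA x hxC _ (hAne x hx).some_mem), hmove]
  have hone : C.filter (fun x => x.2.2 = ∅ ∧ x.2.1 = ∅) =
      if lam = π then {⟨π, ∅, ∅⟩} else ∅ := by
    ext ⟨ρ, D, F⟩
    rw [mem_filter, hC]
    simp only
    constructor
    · rintro ⟨h, rfl, rfl⟩
      obtain ⟨rfl, rfl⟩ := isConfig_empty_iff.1 h
      simp
    · split_ifs with h
      · subst h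
        intro h
        obtain ⟨⟩ := mem_singleton.1 h
        exact ⟨isConfig_empty_iff.2 ⟨rfl, rfl⟩, rfl, rfl⟩
      · intro h
        exact absurd h (notMem_empty _)
  change ∑ x ∈ C.filter _, _ + ∑ x ∈ C.filter _, _ = _
  rw [hzero, hone, add_zero]
  split_ifs
  · simp [configWeight]
  · simp

theorem artStat_pathBoxes (ha : 0 < a) {w : List DyckStep} (hw : IsBallot a b w) (c : ℤ × ℤ) :
    artStat a b (pathBoxes c w) = w.count DyckStep.D + 1 := by
  have h1 := hw.1
  have h2 := count_U_add_count_D w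
  have h3 : a * tilesStat (pathBoxes c w) + b * areaStat (pathBoxes c w) =
      (w.count DyckStep.D + 1) * (a + b) := by
    rw [tilesStat, areaStat, card_pathBoxes, ← h2]
    linear_combination h1
  rw [artStat, h3, Nat.mul_div_cancel _ (by omega)]

end Summation

theorem mainTheorem1 (a b : ℕ) (ha : 0 < a) (hb : 0 < b) (hab : Nat.Coprime a b)
    (S : Set (List DyckStep))
    (hS : S = enlargedPaths a b ∨ S = indecomposableEnlargedPaths a b) (m k : ℕ) :
    (IsUnit (matM S m k) ∧
      ∀ π' π : LatticePath m k,
        (matM S m k)⁻¹ π' π =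
          ∑ D ∈ coverInclusiveTilings S π' π,
            ∏ d ∈ D, (Polynomial.X : Polynomial ℤ) ^ tilesStat d) ∧
    (IsUnit (matN S m k) ∧
      ∀ π' π : LatticePath m k,
        (matN S m k)⁻¹ π' π =
          ∑ D ∈ coverInclusiveTilings S π' π,
            ∏ d ∈ D, (Polynomial.X : Polynomial ℤ) ^ artStat a b d) := by
  have hballot : ∀ w ∈ S, IsBallot a b w := by
    rintro w hw
    rcases hS with rfl | rfl
    · exact isBallot_of_mem_enlargedPaths hw
    · exact isBallot_of_mem_enlargedPaths hw.1
  have hinv : ∀ {T A : Matrix (LatticePath m k) (LatticePath m k) (Polynomial ℤ)}, T * A = 1 →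
      IsUnit A ∧ ∀ π' π, A⁻¹ π' π = T π' π := fun {T A} h =>
    ⟨⟨⟨A, T, mul_eq_one_comm.1 h, h⟩, rfl⟩, fun π' π => by rw [Matrix.inv_eq_left_inv h]⟩
  have hM := tilings_mul_flips (m := m) (k := k) ha hb hballot (u := fun _ => 1)
    (stat := tilesStat) fun _ _ _ => rfl
  have hN := tilings_mul_flips (m := m) (k := k) ha hb hballot
    (u := fun w => w.count DyckStep.D + 1) (stat := artStat a b)
    fun w hw => artStat_pathBoxes ha (hballot w hw)
  simp only [pow_one] at hM
  exact ⟨hinv hM, hinv hN⟩
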